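/- Let $n \ge 0$ be an integer. Let $K_{n+1}$ be the complete graph on the vertex set $\{1, \dots, n+1\}$. To a subgraph $G \subseteq K_{n+1}$ (identified with its edge set) associate the polynomial $p(G) = \prod_{\{i<j\} \in G} (x_i - x_j) \in \mathbb{C}[x_1, \dots, x_{n+1}]$, and call $G$ slim if the complementary edge set $K_{n+1} - G$ is a connected graph on $\{1, \dots, n+1\}$. Let $V_n$ be the $\mathbb{C}$-linear span of the polynomials $p(G)$, where $G$ runs over the slim subgraphs of $K_{n+1}$, and let $V_n(k)$ be its homogeneous piece of polynomial degree $k$; both are stable under the action of the symmetric group $S_{n+1}$ by permutation of the variables. Embed $S_n$ into $S_{n+1}$ by letting $S_n$ act on the first $n$ letters. A Dyck path of size $n$ is a lattice path $D$ from $(0,0)$ to $(n,n)$ with vertical steps $(0,1)$ and horizontal steps $(1,0)$ that stays weakly above the line $y = x$. Its vertical run partition $\lambda(D) \vdash n$ lists the lengths of the maximal contiguous sequences of vertical steps of $D$ in weakly decreasing order, and its area is the number of unit boxes to the upper left of $D$ in the $n \times n$ square with lower left corner at the origin. For a partition $\lambda = (\lambda_1 \ge \dots \ge \lambda_r)$ of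 $n$, let $M^\lambda = \mathbb{C}[S_n / S_\lambda]$ be the permutation module of $S_n$ on the left cosets of the Young subgroup $S_\lambda = S_{\lambda_1} \times \cdots \times S_{\lambda_r}$. Let $\mathrm{Park}_n$ be the $\mathbb{C}$-vector space with basis the parking functions of size $n$, i.e. the sequences $(a_1, \dots, a_n)$ of positive integers whose nondecreasing rearrangement $b_1 \le \dots \le b_n$ satisfies $b_i \le i$ for all $i$, with $S_n$ acting by permutation of positions. Theorem. For every $k \ge 0$, $$\mathrm{Res}^{S_{n+1}}_{S_n}(V_n(k)) \cong_{S_n} \bigoplus_D M^{\lambda(D)},$$ where the direct sum is over all Dyck paths $D$ of size $n$ and area $k$. In particular, $$\mathrm{Res}^{S_{n+1}}_{S_n}(V_n) \cong_{S_n} \mathrm{Park}_n.$$ -/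

import Mathlib

open MvPolynomial

namespace SlimSubgraph

/-! ### The module spanned by the polynomials of the slim subgraphs -/

/-- The weight `x_i - x_j` of an edge `{i < j}` of the complete graph on `Fin m`. -/
noncomputable def edgeWeight {m : ℕ} (e : Sym2 (Fin m)) : MvPolynomial (Fin m) ℂ :=
  X e.inf - X e.sup

open Classical in
/-- The weight `p(G) = ∏_{e ∈ G} p(e)` of a subgraph `G` of the complete graph on `Fin m`. -/
noncomputable def graphWeight {m : ℕ} (G : SimpleGraph (Fin m)) : MvPolynomial (Fin m) ℂ :=
  ∏ e ∈ G.edgeFinset, edgeWeight e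

/-- A subgraph of the complete graph is slim if the complementary edge set is a connected graph
on the whole vertex set. -/
def IsSlim {m : ℕ} (G : SimpleGraph (Fin m)) : Prop := Gᶜ.Connected

/-- The action of the symmetric group on polynomials by permutation of the variables:
`w` sends `x_i` to `x_{w(i)}`. -/
noncomputable def polyRep (m : ℕ) :
    Representation ℂ (Equiv.Perm (Fin m)) (MvPolynomial (Fin m) ℂ) where
  toFun w := (rename w).toLinearMap
  map_one' := LinearMap.ext fun p => rename_id_apply p
  map_mul' v w := LinearMap.ext fun p => (rename_rename w v p).symm

/-- The span `V_n` of the polynomials `p(G)`, over the slim subgraphs `G` of `K_{n+1}`. -/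
noncomputable def slimSpan (n : ℕ) : Submodule ℂ (MvPolynomial (Fin (n + 1)) ℂ) :=
  Submodule.span ℂ {p | ∃ G : SimpleGraph (Fin (n + 1)), IsSlim G ∧ p = graphWeight G}

theorem edgeWeight_map {m : ℕ} (w : Equiv.Perm (Fin m)) (e : Sym2 (Fin m)) :
    ∃ c : ℂ, rename w (edgeWeight e) = c • edgeWeight (e.map w) := by
  induction e with
  | _ i j =>
    rcases le_total i j with h | h <;> rcases le_total (w i) (w j) with h' | h'
    · exact ⟨1, by simp [edgeWeight, h, h']⟩
    · exact ⟨-1, by simp [edgeWeight, h, h']⟩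
    · exact ⟨-1, by simp [edgeWeight, h, h']⟩
    · exact ⟨1, by simp [edgeWeight, h, h']⟩

theorem graphWeight_map {m : ℕ} (w : Equiv.Perm (Fin m)) (G : SimpleGraph (Fin m)) :
    ∃ c : ℂ, rename w (graphWeight G) = c • graphWeight (G.comap w.symm) := by
  classical
  choose c hc using edgeWeight_map w
  refine ⟨∏ e ∈ G.edgeFinset, c e, ?_⟩
  simp only [graphWeight]
  rw [map_prod]
  simp only [hc]
  rw [Finset.prod_smul]
  congr 1
  refine Finset.prod_bij' (fun e _ => e.map w) (fun e _ => e.map w.symm) ?_ ?_ ?_ ?_ ?_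
  · intro e
    induction e with
    | _ i j => simp
  · intro e
    induction e with
    | _ i j => simp
  · intro e _
    induction e with
    | _ i j => simp
  · intro e _
    induction e with
    | _ i j => simp
  · intro e _
    rfl

theorem IsSlim.map {m : ℕ} (w : Equiv.Perm (Fin m)) {G : SimpleGraph (Fin m)} (hG : IsSlim G) :
    IsSlim (G.comap w.symm) := by
  have e : Gᶜ ≃g (G.comap w.symm)ᶜ :=
    ⟨w, by
      intro a b
      simp⟩
  exact e.connected_iff.1 hG

theorem slimSpan_stable (n : ℕ) (w : Equiv.Perm (Fin (n + 1)))
    ⦃p : MvPolynomial (Fin (n + 1)) ℂ⦄ (hp : p ∈ slimSpan n) :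
    polyRep (n + 1) w p ∈ slimSpan n := by
  induction hp using Submodule.span_induction with
  | mem p h =>
    obtain ⟨G, hG, rfl⟩ := h
    obtain ⟨c, hc⟩ := graphWeight_map w G
    change rename w (graphWeight G) ∈ _
    rw [hc]
    exact Submodule.smul_mem _ _ (Submodule.subset_span ⟨_, hG.map w, rfl⟩)
  | zero => simp
  | add p q _ _ hp hq => simpa using Submodule.add_mem _ hp hq
  | smul a p _ hp => simpa using Submodule.smul_mem _ a hp

/-- `V_n` as a subrepresentation of the `S_{n+1}`-module `ℂ[x_1, …, x_{n+1}]`. -/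
noncomputable def slimModule (n : ℕ) : Subrepresentation (polyRep (n + 1)) where
  toSubmodule := slimSpan n
  apply_mem_toSubmodule := slimSpan_stable n

/-- The homogeneous piece `V_n(k)` of polynomial degree `k`, an `S_{n+1}`-submodule of `V_n`. -/
noncomputable def slimModuleDeg (n k : ℕ) : Subrepresentation (polyRep (n + 1)) where
  toSubmodule := slimSpan n ⊓ homogeneousSubmodule (Fin (n + 1)) ℂ k
  apply_mem_toSubmodule w _ hp :=
    ⟨slimSpan_stable n w hp.1, IsHomogeneous.rename_isHomogeneous hp.2⟩

/-- The embedding of `S_n` in `S_{n+1}` as the group of permutations of the first `n` letters,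
fixing the last one. -/
noncomputable def permEmb (n : ℕ) : Equiv.Perm (Fin n) →* Equiv.Perm (Fin (n + 1)) :=
  Equiv.Perm.viaEmbeddingHom Fin.castSuccEmb

/-- The restriction of `V_n` from `S_{n+1}` to `S_n`. -/
noncomputable def resSlim (n : ℕ) :
    Representation ℂ (Equiv.Perm (Fin n)) (slimModule n).toSubmodule :=
  (slimModule n).toRepresentation.comp (permEmb n)

/-- The restriction of `V_n(k)` from `S_{n+1}` to `S_n`. -/
noncomputable def resSlimDeg (n k : ℕ) :
    Representation ℂ (Equiv.Perm (Fin n)) (slimModuleDeg n k).toSubmodule :=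
  (slimModuleDeg n k).toRepresentation.comp (permEmb n)

/-! ### Coset modules -/

/-- The parts of a partition `λ` of `n`, listed in weakly decreasing order. -/
def partitionComposition {n : ℕ} (lam : n.Partition) : Composition n where
  blocks := lam.parts.sort (· ≥ ·)
  blocks_pos h := lam.parts_pos ((Multiset.mem_sort _).1 h)
  blocks_sum := by
    rw [← Multiset.sum_coe, Multiset.sort_eq, lam.parts_sum]

/-- The Young subgroup `S_{λ_1} × ⋯ × S_{λ_k}` of `S_n`: the permutations that preserve each of
the consecutive blocks of sizes `λ_1 ≥ ⋯ ≥ λ_k`. -/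
def youngSubgroup {n : ℕ} (lam : n.Partition) : Subgroup (Equiv.Perm (Fin n)) where
  carrier := {w | ∀ i, (partitionComposition lam).index (w i) = (partitionComposition lam).index i}
  mul_mem' {v w} hv hw i := by
    rw [Equiv.Perm.mul_apply, hv, hw]
  one_mem' _ := rfl
  inv_mem' {w} hw i := by
    simpa using (hw (w⁻¹ i)).symm

/-- The coset module `M^λ = ℂ[S_n / S_λ]`. -/
noncomputable abbrev cosetModule {n : ℕ} (lam : n.Partition) :
    Representation ℂ (Equiv.Perm (Fin n))
      (MonoidAlgebra ℂ (Equiv.Perm (Fin n) ⧸ youngSubgroup lam)) :=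
  Representation.ofMulAction ℂ (Equiv.Perm (Fin n)) (Equiv.Perm (Fin n) ⧸ youngSubgroup lam)

/-! ### Dyck paths -/

/-- Dyck paths of size `n`: lattice paths from `(0, 0)` to `(n, n)`, with vertical steps `U` and
horizontal steps `D`, that stay weakly above the line `y = x`. -/
abbrev DyckPath (n : ℕ) : Type := {D : DyckWord // D.semilength = n}

/-- The numbers of vertical steps of a path on the successive vertical lines `x = 0, 1, 2, …`;
the positive ones are the lengths of the vertical runs, the maximal contiguous sequences
of vertical steps. -/
def columnRuns : List DyckStep → List ℕ
  | [] => [0]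
  | DyckStep.U :: l => (columnRuns l).modifyHead (· + 1)
  | DyckStep.D :: l => 0 :: columnRuns l

theorem columnRuns_sum (l : List DyckStep) : (columnRuns l).sum = l.count DyckStep.U := by
  induction l with
  | nil => rfl
  | cons s l ih =>
    have hne : columnRuns l ≠ [] := by
      clear ih
      induction l with
      | nil => simp [columnRuns]
      | cons t l ih => cases t <;> simp [columnRuns, ih]
    cases s
    · rw [columnRuns, List.count_cons_self, ← ih]
      cases h : columnRuns l with
      | nil => exact absurd h hne
      | cons a r => simp; omega
    · simp [columnRuns, ih]

/-- The vertical run partition `λ(D)` of `n`: the positive lengths of the vertical runs of `D`. -/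
def DyckPath.runPartition {n : ℕ} (D : DyckPath n) : n.Partition :=
  Nat.Partition.ofSums n (columnRuns D.1.toList) (by
    rw [Multiset.sum_coe, columnRuns_sum]
    exact D.2)

/-- The `x`-coordinates of the successive vertical steps of a path that starts on the vertical line
with first coordinate `x`. For a Dyck path with start at `x = 0`, the entry of a vertical step is
the number of boxes to the left of that step in its row of the `n × n` square. -/
def rowAreas : ℕ → List DyckStep → List ℕ
  | _, [] => []
  | x, DyckStep.U :: l => x :: rowAreas x l
  | x, DyckStep.D :: l => rowAreas (x + 1) l

/-- The area of a Dyck path: the number of boxes to the upper left of the path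
in the `n × n` square. -/
def DyckPath.area {n : ℕ} (D : DyckPath n) : ℕ := (rowAreas 0 D.1.toList).sum

/-! ### Parking functions -/

/-- The sequences `(a_1, …, a_n)` of positive integers whose nondecreasing rearrangement
`b_1 ≤ ⋯ ≤ b_n` satisfies `b_i ≤ i` for all `i`. -/
def ParkingFunction (n : ℕ) : Type :=
  {a : Fin n → ℕ // (∀ i, 1 ≤ a i) ∧ ∀ i : Fin n, (a ∘ Tuple.sort a) i ≤ (i : ℕ) + 1}

/-- `S_n` permutes the positions of a parking function: the entry of `a` at position `i` is moved
to position `w(i)`. -/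
instance (n : ℕ) : MulAction (Equiv.Perm (Fin n)) (ParkingFunction n) where
  smul w a := ⟨a.1 ∘ ⇑w⁻¹, fun i => a.2.1 _, fun i => by
    rw [Tuple.comp_perm_comp_sort_eq_comp_sort]
    exact a.2.2 i⟩
  one_smul _ := rfl
  mul_smul v w a := Subtype.ext (by
    change a.1 ∘ ⇑(v * w)⁻¹ = (a.1 ∘ ⇑w⁻¹) ∘ ⇑v⁻¹
    rw [mul_inv_rev]
    rfl)

/-- The permutation module `Park_n`, with basis the parking functions of size `n`. -/
noncomputable abbrev parkModule (n : ℕ) :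
    Representation ℂ (Equiv.Perm (Fin n)) (MonoidAlgebra ℂ (ParkingFunction n)) :=
  Representation.ofMulAction ℂ (Equiv.Perm (Fin n)) (ParkingFunction n)

end SlimSubgraph

/-! The isomorphism reads off coefficients. To `p` in `V_n` attach its coefficients at the monomials
`x^c` without `x_{n+1}` whose exponent vector `c` is a parking function in zero-based form. This map
commutes with `S_n`, which fixes `x_{n+1}`, and it matches the degree of a polynomial with the sum
of `c`. What has to be shown is that it is bijective onto the functions on parking functions.

Injectivity (`eq_zero_of_coeff_park`). Translation invariance makes `p` determined by its terms
without `x_{n+1}`. If `c` is not parking, some set `I` of `k` variables has all its exponents at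
least `n+1-k`. Shift the variables of `I` by `t`. An edge weight depends on `t` only if the edge
leaves `I`, and a slim graph misses at least one of the `k(n+1-k)` edges leaving `I`, so the degree
in `t` is less than `k(n+1-k)`. A nonzero slice of `p`, with the exponents outside `I` fixed,
therefore cannot be divisible by `∏ x_i^(n+1-k)`, which would contribute degree `k(n+1-k)`. The
terms of the slice that are not divisible have a smaller violation of the parking condition, so
induction on `defect` kills them, and then the whole slice.

Surjectivity (`map_parkCoeff_slimSpan`). Order the vertices with the root `n+1` first so that `c v`
is less than the rank of `v`, and join each `v` to the first `c v` vertices. This graph is slim.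
Expanding its weight sums over orientations, with indegrees as exponents. By double counting edges,
`c` occurs with coefficient `1`, and every other exponent without `x_{n+1}` is smaller in a
lexicographic order (`IsPark.exists_mem_slimSpan`). So the system is triangular.

Finally, the sorted entries of a zero-based parking function are the row areas of a unique Dyck path
`D`, and its rearrangements form an orbit isomorphic to `S_n / S_{λ(D)}` (`arrange_bijective`). -/

namespace SlimSubgraph

open scoped DirectSum

/-! ### Shifting a set of variables and the degree in the shift parameter -/

section Shift

variable {V : Type*} [DecidableEq V]

/-- The substitution `x_i ↦ x_i + t` for `i ∈ I`, where the shifted variables and the parameter `t`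
are moved to the coefficients. -/
noncomputable def shiftHom (I : Finset V) :
    MvPolynomial V ℂ →ₐ[ℂ] MvPolynomial V (Polynomial (MvPolynomial V ℂ)) :=
  aeval fun i => if i ∈ I then C (Polynomial.X + Polynomial.C (X i)) else X i

/-- The degree in the shift parameter `t` is at most `d`. -/
def ShiftDegLE (d : ℕ) (F : MvPolynomial V (Polynomial (MvPolynomial V ℂ))) : Prop :=
  ∀ u, (coeff u F).natDegree ≤ d

theorem ShiftDegLE.mul {d e : ℕ} {F G : MvPolynomial V (Polynomial (MvPolynomial V ℂ))}
    (hF : ShiftDegLE d F) (hG : ShiftDegLE e G) : ShiftDegLE (d + e) (F * G) := by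
  intro u
  rw [coeff_mul]
  exact Polynomial.natDegree_sum_le_of_forall_le _ _ fun x _ =>
    Polynomial.natDegree_mul_le.trans (add_le_add (hF _) (hG _))

omit [DecidableEq V] in
theorem ShiftDegLE.add {d : ℕ} {F G : MvPolynomial V (Polynomial (MvPolynomial V ℂ))}
    (hF : ShiftDegLE d F) (hG : ShiftDegLE d G) : ShiftDegLE d (F + G) := by
  intro u
  rw [coeff_add]
  exact Polynomial.natDegree_add_le_of_degree_le (hF u) (hG u)

theorem shiftDegLE_C (p : Polynomial (MvPolynomial V ℂ)) (d : ℕ) (hp : p.natDegree ≤ d) :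
    ShiftDegLE d (C p : MvPolynomial V (Polynomial (MvPolynomial V ℂ))) := by
  intro u
  rw [coeff_C]
  split_ifs
  · exact hp
  · simp

theorem shiftDegLE_X (i : V) (d : ℕ) :
    ShiftDegLE d (X i : MvPolynomial V (Polynomial (MvPolynomial V ℂ))) := by
  intro u
  rw [coeff_X]
  split_ifs <;> simp

omit [DecidableEq V] in
theorem ShiftDegLE.neg {d : ℕ} {F : MvPolynomial V (Polynomial (MvPolynomial V ℂ))}
    (hF : ShiftDegLE d F) : ShiftDegLE d (-F) := by
  intro u
  rw [coeff_neg, Polynomial.natDegree_neg]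
  exact hF u

theorem ShiftDegLE.prod {ι : Type*} (s : Finset ι) (d : ι → ℕ)
    (F : ι → MvPolynomial V (Polynomial (MvPolynomial V ℂ)))
    (h : ∀ i ∈ s, ShiftDegLE (d i) (F i)) : ShiftDegLE (∑ i ∈ s, d i) (∏ i ∈ s, F i) := by
  classical
  induction s using Finset.induction_on with
  | empty =>
    simpa using shiftDegLE_C (V := V) 1 0 (by simp)
  | insert i s hi ih =>
    rw [Finset.sum_insert hi, Finset.prod_insert hi]
    exact (h i (by simp)).mul (ih fun j hj => h j (by simp [hj]))

/-- The parameter cancels in the difference unless exactly one of the two variables is shifted. -/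
theorem shiftHom_X_sub_X (I : Finset V) (i j : V) :
    ShiftDegLE (if (i ∈ I ↔ j ∈ I) then 0 else 1) (shiftHom I (X i - X j)) := by
  have h1 : (Polynomial.X + Polynomial.C (X i : MvPolynomial V ℂ)).natDegree ≤ 1 := by
    simp
  have h2 : (Polynomial.X + Polynomial.C (X j : MvPolynomial V ℂ)).natDegree ≤ 1 := by
    simp
  rw [map_sub, shiftHom, aeval_X, aeval_X]
  by_cases hi : i ∈ I <;> by_cases hj : j ∈ I <;> simp only [hi, hj, if_true, if_false, iff_self,
    iff_true, iff_false, not_true]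
  · rw [← map_sub, add_sub_add_left_eq_sub, ← map_sub]
    exact shiftDegLE_C _ _ (by simp)
  · rw [sub_eq_add_neg]
    exact (shiftDegLE_C _ _ h1).add (shiftDegLE_X _ _).neg
  · rw [sub_eq_add_neg]
    exact (shiftDegLE_X _ _).add (shiftDegLE_C _ _ h2).neg
  · rw [sub_eq_add_neg]
    exact (shiftDegLE_X _ _).add (shiftDegLE_X _ _).neg

variable [Fintype V]

theorem shiftHom_monomial (I : Finset V) (m : V →₀ ℕ) (a : ℂ) :
    shiftHom I (monomial m a) = monomial (m.filter (· ∉ I))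
      (Polynomial.C (C a) * ∏ i ∈ I, (Polynomial.X + Polynomial.C (X i)) ^ m i) := by
  rw [shiftHom, aeval_monomial, Finsupp.prod_fintype _ _ (by simp)]
  have h : ∀ i, (if i ∈ I then (C (Polynomial.X + Polynomial.C (X i)) :
      MvPolynomial V (Polynomial (MvPolynomial V ℂ))) else X i) ^ m i =
      C (if i ∈ I then (Polynomial.X + Polynomial.C (X i)) ^ m i else 1) *
        X i ^ (m.filter (· ∉ I)) i := by
    intro i
    by_cases hi : i ∈ I <;> simp [hi]
  rw [Finset.prod_congr rfl fun i _ => h i, Finset.prod_mul_distrib, ← map_prod,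
    Finset.prod_ite_mem, Finset.univ_inter, monomial_eq, Finsupp.prod_fintype _ _ (by simp),
    map_mul, mul_assoc]
  rfl

theorem coeff_shiftHom (I : Finset V) (f : MvPolynomial V ℂ) (u : V →₀ ℕ) :
    coeff u (shiftHom I f) = ∑ m ∈ f.support with m.filter (· ∉ I) = u,
      Polynomial.C (C (coeff m f)) * ∏ i ∈ I, (Polynomial.X + Polynomial.C (X i)) ^ m i := by
  conv_lhs => rw [f.as_sum, map_sum]
  simp_rw [coeff_sum, shiftHom_monomial, coeff_monomial]
  rw [Finset.sum_filter]

/-- If `f` has degree less than `s * |I|` along the diagonal of the variables of `I`, then no slice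
of `f` in these variables is divisible by `∏ i ∈ I, x_i ^ s`, unless it vanishes. -/
theorem coeff_eq_zero_of_slice_divisible {I : Finset V} {s d : ℕ} {f : MvPolynomial V ℂ}
    (hd : d < s * I.card) (hf : ShiftDegLE d (shiftHom I f)) (m₀ : V →₀ ℕ)
    (h : ∀ m, m.filter (· ∉ I) = m₀.filter (· ∉ I) → coeff m f ≠ 0 → ∀ i ∈ I, s ≤ m i) :
    coeff m₀ f = 0 := by
  set u := m₀.filter (· ∉ I) with hu
  have hfac : coeff u (shiftHom I f) =
      (∏ i ∈ I, (Polynomial.X + Polynomial.C (X i)) ^ s) *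
      ∑ m ∈ f.support with m.filter (· ∉ I) = u,
        Polynomial.C (C (coeff m f)) * ∏ i ∈ I, (Polynomial.X + Polynomial.C (X i)) ^ (m i - s) := by
    rw [coeff_shiftHom, Finset.mul_sum]
    refine Finset.sum_congr rfl fun m hm => ?_
    rw [Finset.mem_filter, mem_support_iff] at hm
    rw [mul_left_comm, ← Finset.prod_mul_distrib]
    congr 1
    refine Finset.prod_congr rfl fun i hi => ?_
    rw [← pow_add, Nat.add_sub_cancel' (h m hm.2 hm.1 i hi)]
  have hmonic : ∀ i ∈ I, ((Polynomial.X + Polynomial.C (X i : MvPolynomial V ℂ)) ^ s).Monic :=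
    fun i _ => (Polynomial.monic_X_add_C _).pow s
  -- The extracted factor is monic in `t` of degree `s * |I|`, so a nonzero multiple of it would
  -- exceed the degree bound `d`.
  have hzero : coeff u (shiftHom I f) = 0 := by
    by_contra hne
    rw [hfac] at hne
    have hle := hf u
    rw [hfac, (Polynomial.monic_prod_of_monic _ _ hmonic).natDegree_mul'
      (right_ne_zero_of_mul hne), Polynomial.natDegree_prod_of_monic _ _ hmonic] at hle
    simp only [(Polynomial.monic_X_add_C _).natDegree_pow, Polynomial.natDegree_X_add_C,
      mul_one, Finset.sum_const, smul_eq_mul] at hle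
    rw [mul_comm] at hle
    omega
  rw [coeff_shiftHom] at hzero
  -- Setting `t = 0` recovers the slice of `f` itself; within a slice an exponent is determined by
  -- its part on `I`, so the coefficient at `m₀` can be isolated.
  have hev := congrArg (Polynomial.eval 0) hzero
  rw [Polynomial.eval_finsetSum, Polynomial.eval_zero] at hev
  have hterm : ∀ m : V →₀ ℕ, Polynomial.eval 0 (Polynomial.C (C (coeff m f)) *
      ∏ i ∈ I, (Polynomial.X + Polynomial.C (X i : MvPolynomial V ℂ)) ^ m i) =
      monomial (m.filter (· ∈ I)) (coeff m f) := by
    intro m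
    rw [Polynomial.eval_mul, Polynomial.eval_C, Polynomial.eval_prod, monomial_eq,
      Finsupp.prod_fintype _ _ (by simp)]
    congr 1
    rw [← Finset.univ_inter I, ← Finset.prod_ite_mem]
    refine Finset.prod_congr rfl fun i _ => ?_
    by_cases hi : i ∈ I <;> simp [hi]
  simp_rw [hterm] at hev
  have hc := congrArg (coeff (m₀.filter (· ∈ I))) hev
  rw [coeff_sum, coeff_zero] at hc
  by_contra hne
  rw [Finset.sum_eq_single m₀] at hc
  · rw [coeff_monomial, if_pos rfl] at hc
    exact hne hc
  · intro m hm hmne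
    rw [coeff_monomial, if_neg]
    intro heq
    apply hmne
    rw [Finset.mem_filter] at hm
    rw [← Finsupp.filter_add_filter_not m (· ∈ I), heq,
      ← Finsupp.filter_add_filter_not m₀ (· ∈ I)]
    congr 1
    · simp
    · exact hm.2
  · intro hm
    exact absurd (Finset.mem_filter.2 ⟨mem_support_iff.2 hne, hu.symm⟩) hm

end Shift

/-! ### Degree bound and translation invariance on the slim span -/

section SlimSpan

variable {n : ℕ}

theorem shiftDegLE_edgeWeight (I : Finset (Fin n)) (i j : Fin n) :
    ShiftDegLE (if (i ∈ I ↔ j ∈ I) then 0 else 1) (shiftHom I (edgeWeight s(i, j))) := by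
  rcases le_total i j with h | h
  · simpa [edgeWeight, h] using shiftHom_X_sub_X I i j
  · simpa [edgeWeight, h, iff_comm] using shiftHom_X_sub_X I j i

/-- The weight of a slim graph has degree less than the number of edges of the complete graph
between `I` and its complement, along the diagonal of the variables of `I`. -/
theorem shiftDegLE_graphWeight {G : SimpleGraph (Fin n)} (hG : IsSlim G) {I : Finset (Fin n)}
    (h₁ : I.Nonempty) (h₂ : Iᶜ.Nonempty) :
    ShiftDegLE (I.card * (n - I.card) - 1) (shiftHom I (graphWeight G)) := by
  classical
  obtain ⟨u, hu⟩ := h₁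
  obtain ⟨v, hv⟩ := h₂
  rw [Finset.mem_compl] at hv
  obtain ⟨w⟩ := hG.preconnected u v
  -- A walk in the complement of `G` from `I` to the outside crosses the boundary, which yields an
  -- edge leaving `I` that `G` lacks. This is the `- 1` in the bound.
  obtain ⟨e, -, he₁, he₂⟩ := w.exists_boundary_dart (I : Set (Fin n)) (by simpa) (by simpa)
  let P := (I ×ˢ Iᶜ).filter fun q => G.Adj q.1 q.2
  have hP : P.card ≤ I.card * (n - I.card) - 1 := by
    have : P ⊂ I ×ˢ Iᶜ := by
      refine Finset.filter_ssubset.2 ⟨(e.fst, e.snd), ?_, ?_⟩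
      · simpa using ⟨he₁, he₂⟩
      · have := e.adj
        rw [SimpleGraph.compl_adj] at this
        exact this.2
    have := Finset.card_lt_card this
    rw [Finset.card_product, Finset.card_compl, Fintype.card_fin] at this
    omega
  have hE : ∀ e ∈ G.edgeFinset, ShiftDegLE (if e ∈ P.image (fun q => s(q.1, q.2)) then 1 else 0)
      (shiftHom I (edgeWeight e)) := by
    intro e he
    induction e with
    | _ i j =>
      have hij : G.Adj i j := by simpa using he
      have := shiftDegLE_edgeWeight I i j
      have hmem : s(i, j) ∈ P.image (fun q => s(q.1, q.2)) ↔ ¬ (i ∈ I ↔ j ∈ I) := by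
        simp only [P, Finset.mem_image, Finset.mem_filter, Finset.mem_product, Finset.mem_compl,
          Prod.exists, Sym2.eq_iff]
        constructor
        · rintro ⟨a, b, ⟨⟨ha, hb⟩, -⟩, ⟨rfl, rfl⟩ | ⟨rfl, rfl⟩⟩ <;> tauto
        · intro h
          by_cases hi : i ∈ I
          · exact ⟨i, j, ⟨⟨hi, by tauto⟩, hij⟩, by simp⟩
          · exact ⟨j, i, ⟨⟨by tauto, hi⟩, hij.symm⟩, by simp⟩
      refine (congrArg (ShiftDegLE · _) ?_).mp this
      by_cases h : (i ∈ I ↔ j ∈ I)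
      · rw [if_pos h, if_neg fun h' => hmem.1 h' h]
      · rw [if_neg h, if_pos (hmem.2 h)]
  have hprod := ShiftDegLE.prod _ _ _ hE
  rw [← map_prod] at hprod
  have hw : graphWeight G = ∏ e ∈ G.edgeFinset, edgeWeight e :=
    Finset.prod_congr (by ext; simp) fun _ _ => rfl
  rw [hw]
  intro x
  refine (hprod x).trans (le_trans ?_ ((Finset.card_image_le
    (f := fun q : Fin n × Fin n => s(q.1, q.2))).trans hP))
  rw [← Finset.sum_filter, Finset.sum_const, smul_eq_mul, mul_one]
  exact Finset.card_le_card fun e he => (Finset.mem_filter.1 he).2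

theorem shiftDegLE_of_mem_slimSpan {p : MvPolynomial (Fin (n + 1)) ℂ} (hp : p ∈ slimSpan n)
    {I : Finset (Fin (n + 1))} (h₁ : I.Nonempty) (h₂ : Iᶜ.Nonempty) :
    ShiftDegLE (I.card * (n + 1 - I.card) - 1) (shiftHom I p) := by
  induction hp using Submodule.span_induction with
  | mem p h =>
    obtain ⟨G, hG, rfl⟩ := h
    exact shiftDegLE_graphWeight hG h₁ h₂
  | zero => intro u; simp
  | add p q _ _ hp hq => rw [map_add]; exact hp.add hq
  | smul a p _ hp =>
    rw [map_smul, algebra_compatible_smul (MvPolynomial (Fin (n + 1))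
      (Polynomial (MvPolynomial (Fin (n + 1)) ℂ))), smul_eq_mul]
    have : ShiftDegLE 0 (algebraMap ℂ (MvPolynomial (Fin (n + 1))
      (Polynomial (MvPolynomial (Fin (n + 1)) ℂ))) a) :=
      shiftDegLE_C (Polynomial.C (C a)) 0 (by simp)
    simpa using this.mul hp

/-- The polynomials of the slim span are invariant under translations. -/
theorem aeval_sub_last_of_mem_slimSpan {p : MvPolynomial (Fin (n + 1)) ℂ} (hp : p ∈ slimSpan n) :
    aeval (fun i => (X i - X (Fin.last n) : MvPolynomial (Fin (n + 1)) ℂ)) p = p := by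
  induction hp using Submodule.span_induction with
  | mem p h =>
    obtain ⟨G, -, rfl⟩ := h
    rw [graphWeight, map_prod]
    refine Finset.prod_congr rfl fun e _ => ?_
    rw [edgeWeight, map_sub, aeval_X, aeval_X, sub_sub_sub_cancel_right]
  | zero => simp
  | add p q _ _ hp hq => rw [map_add, hp, hq]
  | smul a p _ hp => rw [map_smul, hp]

/-- The substitution `x_i ↦ x_i - x_{n+1}` fixes `p` and kills every monomial that contains
`x_{n+1}`. -/
theorem eq_zero_of_coeff_last {p : MvPolynomial (Fin (n + 1)) ℂ} (hp : p ∈ slimSpan n)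
    (h : ∀ m : Fin (n + 1) →₀ ℕ, m (Fin.last n) = 0 → coeff m p = 0) : p = 0 := by
  rw [← aeval_sub_last_of_mem_slimSpan hp, aeval_def, eval₂_eq']
  refine Finset.sum_eq_zero fun m hm => ?_
  rw [mem_support_iff] at hm
  have : m (Fin.last n) ≠ 0 := fun h0 => hm (h m h0)
  rw [Finset.prod_eq_zero (Finset.mem_univ (Fin.last n)), mul_zero]
  simp [this]

end SlimSpan

/-! ### Violations of the parking condition and injectivity -/

section Parking

variable {n : ℕ}

/-- The zero-based form of the parking condition: the entries can be arranged so that the `k`-th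
one is at most `k`. -/
def IsPark (c : Fin n → ℕ) : Prop := ∃ σ : Equiv.Perm (Fin n), ∀ k, c (σ k) ≤ k

theorem isPark_iff_sort (c : Fin n → ℕ) :
    IsPark c ↔ ∀ k : Fin n, (c ∘ Tuple.sort c) k ≤ k := by
  refine ⟨?_, fun h => ⟨Tuple.sort c, h⟩⟩
  rintro ⟨σ, hσ⟩ k
  by_contra! hk
  -- Pigeonhole: `σ` provides `k + 1` entries of value at most `k`, but in sorted order they would
  -- all lie before position `k`.
  have hsub : (Finset.Iic k).image σ ⊆ (Finset.Iio k).image (Tuple.sort c) := by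
    intro i hi
    obtain ⟨j, hj, rfl⟩ := Finset.mem_image.1 hi
    refine Finset.mem_image.2 ⟨(Tuple.sort c).symm (σ j), ?_, by simp⟩
    rw [Finset.mem_Iio]
    by_contra! hle
    have h1 := Tuple.monotone_sort c hle
    have h2 := hσ j
    have h3 : j ≤ k := Finset.mem_Iic.1 hj
    simp only [Function.comp_apply, Equiv.apply_symm_apply] at h1 hk
    omega
  have := Finset.card_le_card hsub
  rw [Finset.card_image_of_injective _ σ.injective,
    Finset.card_image_of_injective _ (Tuple.sort c).injective, Fin.card_Iic, Fin.card_Iio] at this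
  omega

/-- The number of entries of `c` which are at least `t`. -/
def countGE (c : Fin n → ℕ) (t : ℕ) : ℕ := (Finset.univ.filter fun i => t ≤ c i).card

/-- The largest size `k` of a violation of the parking condition, a set of `k` entries which are
all greater than `n - k`; it is zero if there is none. -/
def defect (c : Fin n → ℕ) : ℕ := Nat.findGreatest (fun k => k ≤ countGE c (n + 1 - k)) n

theorem defect_le_countGE (c : Fin n → ℕ) : defect c ≤ countGE c (n + 1 - defect c) :=
  Nat.findGreatest_spec (P := fun k => k ≤ countGE c (n + 1 - k)) (Nat.zero_le n) (Nat.zero_le _)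

theorem countGE_lt_of_defect_lt {c : Fin n → ℕ} {k : ℕ} (h : defect c < k) (hk : k ≤ n) :
    countGE c (n + 1 - k) < k :=
  not_le.1 (Nat.findGreatest_is_greatest (P := fun k => k ≤ countGE c (n + 1 - k)) h hk)

theorem defect_le (c : Fin n → ℕ) : defect c ≤ n := Nat.findGreatest_le n

theorem countGE_le (c : Fin n → ℕ) (t : ℕ) : countGE c t ≤ n :=
  (Finset.card_le_univ _).trans_eq (Fintype.card_fin n)

theorem countGE_defect (c : Fin n → ℕ) : countGE c (n + 1 - defect c) = defect c := by
  refine le_antisymm ?_ (defect_le_countGE c)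
  rcases (defect_le c).lt_or_eq with h | h
  · have h1 := countGE_lt_of_defect_lt (Nat.lt_succ_self (defect c)) h
    have h2 : countGE c (n + 1 - defect c) ≤ countGE c (n + 1 - (defect c).succ) :=
      Finset.card_le_card fun i hi => by
        simp only [Finset.mem_filter, Finset.mem_univ, true_and] at hi ⊢
        omega
    omega
  · exact (countGE_le _ _).trans h.ge

theorem isPark_of_defect_eq_zero {c : Fin n → ℕ} (h : defect c = 0) : IsPark c := by
  refine ⟨Tuple.sort c, fun k => ?_⟩
  by_contra! hk
  have hk' := k.2
  -- If the sorted entry at position `k` exceeds `k`, the `n - k` positions from `k` on are a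
  -- violation of size `n - k`, whose threshold is `k + 1`.
  have h1 := countGE_lt_of_defect_lt (c := c) (k := n - k) (by omega) (by omega)
  have h2 : (Finset.Ici k).image (Tuple.sort c) ⊆
      Finset.univ.filter fun i => n + 1 - (n - k) ≤ c i := by
    intro i hi
    obtain ⟨j, hj, rfl⟩ := Finset.mem_image.1 hi
    have := Tuple.monotone_sort c (Finset.mem_Ici.1 hj)
    simp only [Function.comp_apply, Finset.mem_filter, Finset.mem_univ, true_and] at this ⊢
    omega
  have h3 := Finset.card_le_card h2
  rw [Finset.card_image_of_injective _ (Tuple.sort c).injective, Fin.card_Ici] at h3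
  rw [countGE] at h1
  omega

/-- Lowering an entry of the largest violation of the parking condition lowers its size, whatever
the other entries of the violation become. -/
theorem defect_lt_of_agree {c c' : Fin n → ℕ}
    (h : ∀ i, c i < n + 1 - defect c → c' i = c i) {i₀ : Fin n} (h₀ : n + 1 - defect c ≤ c i₀)
    (h₀' : c' i₀ < n + 1 - defect c) : defect c' < defect c := by
  by_contra! hle
  have hspec := defect_le_countGE c'
  rcases hle.lt_or_eq with hlt | heq
  · have h1 := countGE_lt_of_defect_lt hlt (defect_le c')
    -- A larger violation has a lower threshold, which the changed entries already met in `c`; so it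
    -- would be a violation of `c` too.
    have h2 : countGE c' (n + 1 - defect c') ≤ countGE c (n + 1 - defect c') :=
      Finset.card_le_card fun i hi => by
        simp only [Finset.mem_filter, Finset.mem_univ, true_and] at hi ⊢
        by_cases hi' : c i < n + 1 - defect c
        · rwa [← h i hi']
        · omega
    omega
  · rw [← heq] at hspec
    -- At the same threshold no entry is gained and `i₀` is lost.
    have h2 : countGE c' (n + 1 - defect c) < countGE c (n + 1 - defect c) := by
      refine Finset.card_lt_card (Finset.ssubset_iff_of_subset ?_ |>.2 ⟨i₀, ?_, ?_⟩)
      · intro i hi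
        simp only [Finset.mem_filter, Finset.mem_univ, true_and] at hi ⊢
        by_contra! hi'
        rw [h i hi'] at hi
        omega
      · simpa using h₀
      · simpa only [Finset.mem_filter, Finset.mem_univ, true_and, not_le] using h₀'
    rw [countGE_defect] at h2
    omega

/-- The exponent with entries `c` in the first `n` variables and `0` in the last one. -/
noncomputable def boundaryExp (c : Fin n → ℕ) : Fin (n + 1) →₀ ℕ :=
  Finsupp.equivFunOnFinite.symm (Fin.snoc c 0)

@[simp]
theorem boundaryExp_castSucc (c : Fin n → ℕ) (i : Fin n) : boundaryExp c i.castSucc = c i := by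
  simp [boundaryExp]

@[simp]
theorem boundaryExp_last (c : Fin n → ℕ) : boundaryExp c (Fin.last n) = 0 := by
  simp [boundaryExp]

theorem boundaryExp_castSucc_eq {m : Fin (n + 1) →₀ ℕ} (h : m (Fin.last n) = 0) :
    boundaryExp (fun i => m i.castSucc) = m := by
  ext i
  refine Fin.lastCases ?_ (fun i => ?_) i <;> simp [h]

theorem boundaryExp_injective : Function.Injective (boundaryExp (n := n)) := by
  intro b c h
  ext i
  rw [← boundaryExp_castSucc b, h, boundaryExp_castSucc]

/-- Induction on the defect `k` of `c`, with `I` its largest violation and `s = n + 1 - k`. A term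
of the same slice with an exponent below `s` on `I` has smaller defect, so its coefficient vanishes;
the remaining terms are divisible by `∏ x_i ^ s` and fall to the degree bound. -/
theorem coeff_boundaryExp_eq_zero {p : MvPolynomial (Fin (n + 1)) ℂ} (hp : p ∈ slimSpan n)
    (h : ∀ c : Fin n → ℕ, IsPark c → coeff (boundaryExp c) p = 0) (c : Fin n → ℕ) :
    coeff (boundaryExp c) p = 0 := by
  induction hk : defect c using Nat.strong_induction_on generalizing c with
  | _ k ih =>
    rcases Nat.eq_zero_or_pos k with rfl | hpos
    · exact h c (isPark_of_defect_eq_zero hk)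
    have hkn : k ≤ n := hk ▸ defect_le c
    let J : Finset (Fin n) := Finset.univ.filter fun i => n + 1 - k ≤ c i
    let I : Finset (Fin (n + 1)) := J.map Fin.castSuccEmb
    have hI : I.card = k := by
      rw [Finset.card_map]
      have := countGE_defect c
      rwa [hk] at this
    have hlast : Fin.last n ∉ I := by simp [I]
    have hmem : ∀ i : Fin n, i.castSucc ∈ I ↔ n + 1 - k ≤ c i := by simp [I, J]
    have hdeg := shiftDegLE_of_mem_slimSpan hp (I := I)
      (Finset.card_pos.1 (by omega)) ⟨Fin.last n, by simpa using hlast⟩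
    rw [hI] at hdeg
    refine coeff_eq_zero_of_slice_divisible (s := n + 1 - k) ?_ hdeg _ ?_
    · rw [hI, mul_comm (n + 1 - k)]
      -- Positivity is needed because the degree bound `k * (n + 1 - k) - 1` is a truncated
      -- subtraction.
      have : 0 < k * (n + 1 - k) := Nat.mul_pos hpos (by omega)
      omega
    · intro m hm hne
      have hag : ∀ i ∉ I, m i = boundaryExp c i := fun i hi => by
        simpa [Finsupp.filter_apply, hi] using DFunLike.congr_fun hm i
      have hm0 : boundaryExp (fun i => m i.castSucc) = m :=
        boundaryExp_castSucc_eq (by rw [hag _ hlast, boundaryExp_last])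
      by_contra! hcon
      obtain ⟨i, hi, hlt⟩ := hcon
      obtain ⟨j, hj, rfl⟩ := Finset.mem_map.1 hi
      apply hne
      rw [← hm0]
      refine ih (defect fun i => m i.castSucc) ?_ _ rfl
      rw [← hk]
      refine defect_lt_of_agree (i₀ := j) ?_ ?_ ?_ <;> rw [hk]
      · intro i' hi'
        rw [hag _ (by rw [hmem]; omega), boundaryExp_castSucc]
      · exact (hmem j).1 hi
      · exact hlt

/-- A polynomial of the slim span is determined by its coefficients at the parking functions. -/
theorem eq_zero_of_coeff_park {p : MvPolynomial (Fin (n + 1)) ℂ} (hp : p ∈ slimSpan n)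
    (h : ∀ c : Fin n → ℕ, IsPark c → coeff (boundaryExp c) p = 0) : p = 0 := by
  refine eq_zero_of_coeff_last hp fun m hm => ?_
  rw [← boundaryExp_castSucc_eq hm]
  exact coeff_boundaryExp_eq_zero hp h _

end Parking

/-! ### Orientations of the graph of a parking function -/

section Orientation

variable {V : Type*} [Fintype V] [DecidableEq V]

/-- The edges `(v, w)` from each `v` to the first `c v` vertices of an ordering of the vertices,
given by their ranks. -/
def rankEdges (rk c : V → ℕ) : Finset (V × V) := Finset.univ.filter fun q => rk q.2 < c q.1

/-- The indegrees of the orientation of the edges `E` that points at the first vertex of an edge,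
except for the edges of `T`. -/
noncomputable def reorient (E T : Finset (V × V)) : V →₀ ℕ :=
  ∑ q ∈ E \ T, Finsupp.single q.1 1 + ∑ q ∈ T, Finsupp.single q.2 1

omit [Fintype V] in
theorem reorient_apply (E T : Finset (V × V)) (v : V) :
    reorient E T v = ((E \ T).filter fun q => q.1 = v).card + (T.filter fun q => q.2 = v).card := by
  simp [reorient, Finsupp.single_apply]

omit [Fintype V] in
theorem sum_card_fiber {ι : Type*} (s : Finset ι) (f : ι → V) (S : Finset V) :
    ∑ v ∈ S, (s.filter fun q => f q = v).card = (s.filter fun q => f q ∈ S).card := by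
  rw [Finset.card_eq_sum_card_fiberwise (s := s.filter fun q => f q ∈ S) (t := S) (f := f)
    fun q hq => (Finset.mem_filter.1 hq).2]
  refine Finset.sum_congr rfl fun v hv => ?_
  rw [Finset.filter_filter]
  congr 1
  ext q
  simp only [Finset.mem_filter]
  constructor
  · rintro ⟨h, rfl⟩
    exact ⟨h, hv, rfl⟩
  · rintro ⟨h, -, h'⟩
    exact ⟨h, h'⟩

/-- The data of a parking function `c` on the vertices other than the root: an ordering `rk` of the
vertices that starts at the root, with `c v` less than the rank of `v`. -/
structure IsRanked (root : V) (rk c : V → ℕ) : Prop where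
  root_eq : c root = 0
  lt_rank : ∀ v, v ≠ root → c v < rk v
  card_lt : ∀ v, (Finset.univ.filter fun w => rk w < c v).card = c v
  card_le : ∀ r v, r ≤ c v → (Finset.univ.filter fun w => rk w < r).card = r

variable {root : V} {rk c : V → ℕ}

theorem IsRanked.card_edges (h : IsRanked root rk c) (v : V) :
    ((rankEdges rk c).filter fun q => q.1 = v).card = c v := by
  rw [← h.card_lt v, ← Finset.card_image_of_injective (Finset.univ.filter fun w => rk w < c v)
    (Prod.mk_right_injective v)]
  congr 1
  ext ⟨a, b⟩
  simp only [rankEdges, Finset.mem_filter, Finset.mem_univ, true_and, Finset.mem_image,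
    Prod.mk.injEq]
  constructor
  · rintro ⟨h, rfl⟩
    exact ⟨b, h, rfl, rfl⟩
  · rintro ⟨b, h, rfl, rfl⟩
    exact ⟨h, rfl⟩

theorem IsRanked.reorient_empty (h : IsRanked root rk c) (v : V) :
    reorient (rankEdges rk c) ∅ v = c v := by
  rw [reorient_apply, Finset.sdiff_empty, h.card_edges]
  simp

/-- If a reorientation agrees with `c` on the vertices with `c v < r`, then no edge that points at
such a vertex, or at the root, is reversed. -/
theorem IsRanked.mem_of_reversed (h : IsRanked root rk c) {T : Finset (V × V)}
    (hT : T ⊆ rankEdges rk c) (hroot : reorient (rankEdges rk c) T root = 0) {r : ℕ}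
    (hlow : ∀ v, c v < r → reorient (rankEdges rk c) T v = c v) {q : V × V} (hq : q ∈ T)
    (hq2 : q.2 = root ∨ c q.2 < r) : q.1 = root ∨ c q.1 < r := by
  let S : Finset V := Finset.univ.filter fun v => v = root ∨ c v < r
  have hS : ∀ v, v ∈ S ↔ v = root ∨ c v < r := by simp [S]
  -- Comparing total indegrees over `S` shows that as many reversed edges have their second vertex
  -- in `S` as have their first.
  have hsum : ∑ v ∈ S, reorient (rankEdges rk c) T v = ∑ v ∈ S, c v := by
    refine Finset.sum_congr rfl fun v hv => ?_
    rcases (hS v).1 hv with rfl | hv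
    · rw [hroot, h.root_eq]
    · exact hlow v hv
  simp_rw [reorient_apply, ← h.card_edges] at hsum
  rw [Finset.sum_add_distrib, sum_card_fiber, sum_card_fiber, sum_card_fiber] at hsum
  have hsplit : ((rankEdges rk c).filter fun q => q.1 ∈ S).card =
      ((rankEdges rk c \ T).filter fun q => q.1 ∈ S).card + (T.filter fun q => q.1 ∈ S).card := by
    rw [← Finset.card_union_of_disjoint, ← Finset.filter_union, Finset.sdiff_union_of_subset hT]
    exact Finset.disjoint_filter_filter Finset.sdiff_disjoint
  -- Along an edge `(v, w)` with `w` not the root, `c w < rk w < c v`; so a first vertex in `S`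
  -- forces the second into `S`. Equal cardinalities then give the converse.
  have hsub : (T.filter fun q => q.1 ∈ S) ⊆ T.filter fun q => q.2 ∈ S := by
    intro p hp
    rw [Finset.mem_filter, hS] at hp ⊢
    refine ⟨hp.1, ?_⟩
    have hE := hT hp.1
    simp only [rankEdges, Finset.mem_filter, Finset.mem_univ, true_and] at hE
    by_cases hp2 : p.2 = root
    · exact Or.inl hp2
    · have := h.lt_rank _ hp2
      rcases hp.2 with h1 | h1
      · rw [h1, h.root_eq] at hE
        omega
      · right
        omega
  have heq := Finset.eq_of_subset_of_card_le hsub (by omega)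
  have : q ∈ T.filter fun q => q.1 ∈ S := by
    rw [heq, Finset.mem_filter, hS]
    exact ⟨hq, hq2⟩
  rw [Finset.mem_filter, hS] at this
  exact this.2

theorem IsRanked.low_of_mem (h : IsRanked root rk c) {q : V × V} (hq : q ∈ rankEdges rk c) :
    q.2 = root ∨ c q.2 < c q.1 := by
  simp only [rankEdges, Finset.mem_filter, Finset.mem_univ, true_and] at hq
  by_cases hp2 : q.2 = root
  · exact Or.inl hp2
  · have := h.lt_rank _ hp2
    right
    omega

theorem IsRanked.eq_empty (h : IsRanked root rk c) {T : Finset (V × V)} (hT : T ⊆ rankEdges rk c)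
    (hc : ∀ v, reorient (rankEdges rk c) T v = c v) : T = ∅ := by
  by_contra hne
  obtain ⟨q, hq⟩ := Finset.nonempty_iff_ne_empty.2 hne
  have hE := hT hq
  rcases h.mem_of_reversed hT (by rw [hc, h.root_eq]) (r := c q.1) (fun v _ => hc v) hq
    (h.low_of_mem hE) with h1 | h1
  -- The root has `c = 0`, hence is the first vertex of no edge.
  · simp only [rankEdges, Finset.mem_filter, Finset.mem_univ, true_and] at hE
    rw [h1, h.root_eq] at hE
    omega
  · omega

theorem IsRanked.le_of_reorient_le (h : IsRanked root rk c) {T : Finset (V × V)}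
    (hT : T ⊆ rankEdges rk c) (hroot : reorient (rankEdges rk c) T root = 0) {r : ℕ}
    (hlow : ∀ v, c v < r → reorient (rankEdges rk c) T v = c v) {v : V}
    (hv : reorient (rankEdges rk c) T v ≤ r) : c v ≤ r := by
  by_contra! hlt
  -- If `c v > r`, the edges from `v` to the first `r + 1` vertices exist, and none is reversed:
  -- their second vertices are low or the root, while `v` is neither. They alone give `v` indegree
  -- at least `r + 1`.
  have hsub : (Finset.univ.filter fun w => rk w < r + 1).image (Prod.mk v) ⊆
      (rankEdges rk c \ T).filter fun q => q.1 = v := by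
    intro q hq
    obtain ⟨w, hw, rfl⟩ := Finset.mem_image.1 hq
    simp only [Finset.mem_filter, Finset.mem_univ, true_and] at hw
    rw [Finset.mem_filter, Finset.mem_sdiff]
    refine ⟨⟨?_, fun hmem => ?_⟩, rfl⟩
    · simp only [rankEdges, Finset.mem_filter, Finset.mem_univ, true_and]
      omega
    · have hw2 : w = root ∨ c w < r := by
        by_cases hw0 : w = root
        · exact Or.inl hw0
        · have := h.lt_rank w hw0
          right
          omega
      rcases h.mem_of_reversed hT hroot hlow hmem hw2 with h1 | h1
      · dsimp only at h1
        rw [h1, h.root_eq] at hlt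
        omega
      · dsimp only at h1
        omega
  have hcard := Finset.card_le_card hsub
  rw [Finset.card_image_of_injective _ (Prod.mk_right_injective v), h.card_le _ v hlt] at hcard
  rw [reorient_apply] at hv
  omega

/-- A reorientation with indegrees different from `c`, and indegree zero at the root, has fewer
vertices of small indegree, at the first place where these sets of vertices differ. -/
theorem IsRanked.exists_level (h : IsRanked root rk c) {T : Finset (V × V)}
    (hT : T ⊆ rankEdges rk c) (hroot : reorient (rankEdges rk c) T root = 0)
    (hne : ∃ v, reorient (rankEdges rk c) T v ≠ c v) :
    ∃ r, (∀ s < r, ∀ v, reorient (rankEdges rk c) T v ≤ s ↔ c v ≤ s) ∧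
      (∀ v, reorient (rankEdges rk c) T v ≤ r → c v ≤ r) ∧
      ∃ v, c v ≤ r ∧ r < reorient (rankEdges rk c) T v := by
  classical
  have hex : ∃ r, ∃ v, ¬ (reorient (rankEdges rk c) T v ≤ r ↔ c v ≤ r) := by
    obtain ⟨v, hv⟩ := hne
    refine ⟨min (reorient (rankEdges rk c) T v) (c v), v, ?_⟩
    omega
  have hmin : ∀ s < Nat.find hex, ∀ v, reorient (rankEdges rk c) T v ≤ s ↔ c v ≤ s :=
    fun s hs v => not_not.1 fun hn => Nat.find_min hex hs ⟨v, hn⟩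
  have hle : ∀ v, reorient (rankEdges rk c) T v ≤ Nat.find hex → c v ≤ Nat.find hex := by
    intro v hv
    -- Agreement of all sublevel sets below the first differing level forces equality of values at
    -- every `w` with `c w` below that level.
    refine h.le_of_reorient_le hT hroot (fun w hw => ?_) hv
    have h1 := (hmin _ hw w).2 le_rfl
    have h2 := (hmin _ (h1.trans_lt hw) w).1 le_rfl
    omega
  refine ⟨Nat.find hex, hmin, hle, ?_⟩
  obtain ⟨v, hv⟩ := Nat.find_spec hex
  have := hle v
  exact ⟨v, by tauto, not_le.1 (by tauto)⟩

-- Expanding the product chooses one endpoint of each edge; `T` collects the edges where the second,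
-- negative term is chosen.
omit [Fintype V] in
theorem prod_edges_eq_sum (E : Finset (V × V)) :
    ∏ q ∈ E, (X q.1 - X q.2 : MvPolynomial V ℂ) =
      ∑ T ∈ E.powerset, monomial (reorient E T) ((-1) ^ T.card) := by
  rw [Finset.prod_sub]
  refine Finset.sum_congr rfl fun T _ => ?_
  have h : ∀ (A : Finset (V × V)) (f : V × V → V), (∏ q ∈ A, X (f q) : MvPolynomial V ℂ) =
      monomial (∑ q ∈ A, Finsupp.single (f q) 1) 1 := fun A f => by
    rw [monomial_sum_one]
    rfl
  rw [h _ Prod.fst, h _ Prod.snd, mul_assoc, monomial_mul, one_mul, reorient]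
  conv_rhs => rw [← mul_one ((-1 : ℂ) ^ T.card), ← C_mul_monomial]
  simp

omit [Fintype V] in
theorem exists_reorient_of_coeff_ne_zero {E : Finset (V × V)} {b : V →₀ ℕ}
    (h : coeff b (∏ q ∈ E, (X q.1 - X q.2 : MvPolynomial V ℂ)) ≠ 0) :
    ∃ T ⊆ E, reorient E T = b := by
  rw [prod_edges_eq_sum, coeff_sum] at h
  obtain ⟨T, hT, hne⟩ := Finset.exists_ne_zero_of_sum_ne_zero h
  rw [coeff_monomial] at hne
  exact ⟨T, Finset.mem_powerset.1 hT, by_contra fun h' => hne (if_neg h')⟩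

theorem IsRanked.coeff_prod_edges (h : IsRanked root rk c) {m : V →₀ ℕ} (hm : ∀ v, m v = c v) :
    coeff m (∏ q ∈ rankEdges rk c, (X q.1 - X q.2 : MvPolynomial V ℂ)) = 1 := by
  rw [prod_edges_eq_sum, coeff_sum, Finset.sum_eq_single ∅]
  · rw [coeff_monomial, if_pos, Finset.card_empty, pow_zero]
    ext v
    rw [h.reorient_empty, hm]
  · intro T hT hne
    rw [coeff_monomial, if_neg]
    intro heq
    exact hne (h.eq_empty (Finset.mem_powerset.1 hT) fun v => by rw [heq, hm])
  · simp

/-- The graph formed by the edges from each vertex `v` to the first `c v` vertices. -/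
def rankGraph (rk c : V → ℕ) : SimpleGraph V :=
  SimpleGraph.fromRel fun v w => rk w < c v

theorem IsRanked.lt_of_rank_lt (h : IsRanked root rk c) {v w : V} (hvw : rk w < c v) :
    rk w < rk v := by
  by_cases hv : v = root
  · rw [hv, h.root_eq] at hvw
    omega
  · exact hvw.trans (h.lt_rank v hv)

theorem IsRanked.rankGraph_adj (h : IsRanked root rk c) {v w : V} :
    (rankGraph rk c).Adj v w ↔ rk w < c v ∨ rk v < c w := by
  rw [rankGraph, SimpleGraph.fromRel_adj, and_iff_right_iff_imp]
  rintro (h' | h') rfl <;> exact (h.lt_of_rank_lt h').false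

/-- In the complement of the rank graph, each vertex `v` but the root is joined to the vertex of
rank `c v`. -/
theorem IsRanked.compl_connected (h : IsRanked root rk c)
    (hrk : ∀ v, v ≠ root → ∃ w, rk w = c v) : (rankGraph rk c)ᶜ.Connected := by
  have hreach : ∀ v, (rankGraph rk c)ᶜ.Reachable v root := by
    intro v
    induction hv : rk v using Nat.strong_induction_on generalizing v with
    | _ k ih =>
      by_cases hvr : v = root
      · rw [hvr]
      obtain ⟨w, hw⟩ := hrk v hvr
      have hlt := h.lt_rank v hvr
      have hadj : (rankGraph rk c)ᶜ.Adj v w := by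
        rw [SimpleGraph.compl_adj, h.rankGraph_adj]
        refine ⟨?_, ?_⟩
        · rintro rfl
          omega
        · rintro (h' | h')
          · omega
          · have := h.lt_of_rank_lt h'
            omega
      exact hadj.reachable.trans (ih (rk w) (by omega) w rfl)
  have : Nonempty V := ⟨root⟩
  exact ⟨fun v w => (hreach v).trans (hreach w).symm⟩

end Orientation

/-! ### Triangularity and surjectivity -/

section Spanning

variable {n : ℕ}

/-- Ranks strictly decrease along the ordered pairs of `rankEdges`, so each edge of the graph comes
from exactly one pair; the scalar `a` is the product of the orientation signs. -/
theorem IsRanked.graphWeight_rankGraph {root : Fin n} {rk c : Fin n → ℕ}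
    (h : IsRanked root rk c) :
    ∃ a : ℂ, a • graphWeight (rankGraph rk c) =
      ∏ q ∈ rankEdges rk c, (X q.1 - X q.2 : MvPolynomial (Fin n) ℂ) := by
  classical
  have hsign : ∀ q : Fin n × Fin n, ∃ a : ℂ,
      (X q.1 - X q.2 : MvPolynomial (Fin n) ℂ) = a • edgeWeight s(q.1, q.2) := by
    intro q
    rcases le_total q.1 q.2 with hq | hq
    · exact ⟨1, by simp [edgeWeight, hq]⟩
    · exact ⟨-1, by simp [edgeWeight, hq]⟩
  choose a ha using hsign
  refine ⟨∏ q ∈ rankEdges rk c, a q, ?_⟩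
  rw [Finset.prod_congr rfl fun q _ => ha q, Finset.prod_smul]
  congr 1
  symm
  refine Finset.prod_bij (fun q _ => s(q.1, q.2)) ?_ ?_ ?_ fun _ _ => rfl
  · intro q hq
    simp only [rankEdges, Finset.mem_filter, Finset.mem_univ, true_and] at hq
    simp only [SimpleGraph.mem_edgeFinset, SimpleGraph.mem_edgeSet]
    exact h.rankGraph_adj.2 (Or.inl hq)
  · rintro ⟨v, w⟩ hq ⟨v', w'⟩ hq' heq
    simp only [rankEdges, Finset.mem_filter, Finset.mem_univ, true_and] at hq hq'
    rcases Sym2.eq_iff.1 heq with ⟨rfl, rfl⟩ | ⟨rfl, rfl⟩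
    · rfl
    · have h1 := h.lt_of_rank_lt hq
      have h2 := h.lt_of_rank_lt hq'
      dsimp only at h1 h2
      omega
  · intro e he
    induction e with
    | _ v w =>
      simp only [SimpleGraph.mem_edgeFinset, SimpleGraph.mem_edgeSet] at he
      rcases h.rankGraph_adj.1 he with h' | h'
      · exact ⟨(v, w), by simpa [rankEdges] using h', rfl⟩
      · exact ⟨(w, v), by simpa [rankEdges] using h', Sym2.eq_swap⟩

theorem card_rank_lt {rk : Fin (n + 1) → Fin (n + 1)} (hrk : Function.Bijective rk) {r : ℕ}
    (hr : r ≤ n + 1) : (Finset.univ.filter fun w => (rk w : ℕ) < r).card = r := by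
  rw [← Finset.card_image_of_injective _ hrk.1]
  have : (Finset.univ.filter fun w => (rk w : ℕ) < r).image rk =
      Finset.univ.filter fun k : Fin (n + 1) => (k : ℕ) < r := by
    ext k
    obtain ⟨w, rfl⟩ := hrk.2 k
    simp [hrk.1.eq_iff]
  rw [this, Fin.card_filter_val_lt, min_eq_right hr]

theorem IsPark.exists_ranked {c : Fin n → ℕ} (hc : IsPark c) :
    ∃ rk : Fin (n + 1) → ℕ, IsRanked (Fin.last n) rk (boundaryExp c) ∧
      ∀ v, v ≠ Fin.last n → ∃ w, rk w = boundaryExp c v := by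
  obtain ⟨σ, hσ⟩ := hc
  -- The root gets rank `0` and the vertex `σ k` rank `k + 1`; the parking bound `c (σ k) ≤ k`
  -- becomes the strict inequality with the rank.
  let rk : Fin (n + 1) → Fin (n + 1) := Fin.snoc (fun i => (σ.symm i).succ) 0
  have hinj : Function.Injective rk := by
    intro v w
    refine Fin.lastCases ?_ (fun i => ?_) v <;> refine Fin.lastCases ?_ (fun j => ?_) w <;>
      simp [rk, Fin.succ_ne_zero, (Fin.succ_ne_zero _).symm]
  have hbij : Function.Bijective rk := Finite.injective_iff_bijective.1 hinj
  have hlt : ∀ v, v ≠ Fin.last n → boundaryExp c v < rk v := by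
    intro v
    refine Fin.lastCases (fun h => absurd rfl h) (fun i _ => ?_) v
    have := hσ (σ.symm i)
    rw [Equiv.apply_symm_apply] at this
    simpa [rk, Nat.lt_succ_iff] using this
  have hle : ∀ v, boundaryExp c v ≤ n := by
    intro v
    by_cases hv : v = Fin.last n
    · simp [hv]
    · have := hlt v hv
      have := (rk v).2
      omega
  refine ⟨fun v => rk v, ⟨boundaryExp_last c, hlt, fun v => ?_, fun r v hr => ?_⟩, fun v _ => ?_⟩
  · exact card_rank_lt hbij ((hle v).trans (Nat.le_succ n))
  · exact card_rank_lt hbij (hr.trans ((hle v).trans (Nat.le_succ n)))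
  · obtain ⟨w, hw⟩ := hbij.2 ⟨boundaryExp c v, Nat.lt_succ_of_le (hle v)⟩
    exact ⟨w, congrArg Fin.val hw⟩

/-- The number of entries of `c` which are at most `r`, for all `r`. -/
def levelCounts (c : Fin n → ℕ) : ℕ → ℕ := fun r =>
  (Finset.univ.filter fun i => c i ≤ r).card

/-- Each parking function is the largest exponent of a polynomial of the slim span, among the
exponents with zero in the last variable. -/
theorem IsPark.exists_mem_slimSpan {c : Fin n → ℕ} (hc : IsPark c) :
    ∃ p ∈ slimSpan n, coeff (boundaryExp c) p = 1 ∧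
      ∀ b, b ≠ c → coeff (boundaryExp b) p ≠ 0 → toLex (levelCounts b) < toLex (levelCounts c) := by
  obtain ⟨rk, h, hrk⟩ := hc.exists_ranked
  obtain ⟨a, ha⟩ := h.graphWeight_rankGraph
  refine ⟨∏ q ∈ rankEdges rk (boundaryExp c), (X q.1 - X q.2), ?_,
    h.coeff_prod_edges fun _ => rfl, fun b hbc hb => ?_⟩
  · rw [← ha]
    exact Submodule.smul_mem _ _ (Submodule.subset_span ⟨_, h.compl_connected hrk, rfl⟩)
  · obtain ⟨T, hT, hTb⟩ := exists_reorient_of_coeff_ne_zero hb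
    have hne : ∃ v, reorient (rankEdges rk (boundaryExp c)) T v ≠ boundaryExp c v := by
      by_contra! hall
      exact hbc (boundaryExp_injective (by rw [← hTb]; exact Finsupp.ext hall))
    obtain ⟨r, h1, h2, v, h3, h4⟩ := h.exists_level hT (by rw [hTb, boundaryExp_last]) hne
    rw [hTb] at h1 h2 h4
    refine ⟨r, fun s hs => ?_, ?_⟩
    · rw [Pi.toLex_apply, Pi.toLex_apply, levelCounts, levelCounts]
      congr 1
      ext i
      simpa using h1 s hs i.castSucc
    · rw [Pi.toLex_apply, Pi.toLex_apply, levelCounts, levelCounts]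
      refine Finset.card_lt_card ((Finset.ssubset_iff_of_subset fun i hi => ?_).2 ?_)
      · simpa using h2 i.castSucc (by simpa using hi)
      · revert h3 h4
        refine Fin.lastCases ?_ (fun i => ?_) v
        · simp
        · intro h3 h4
          exact ⟨i, by simpa using h3, by simpa using h4⟩

/-- The coefficients at the parking functions. -/
noncomputable def parkCoeff (n : ℕ) :
    MvPolynomial (Fin (n + 1)) ℂ →ₗ[ℂ] ({c : Fin n → ℕ // IsPark c} → ℂ) :=
  LinearMap.pi fun c => lcoeff ℂ (boundaryExp c.1)

@[simp]
theorem parkCoeff_apply (p : MvPolynomial (Fin (n + 1)) ℂ) (c : {c : Fin n → ℕ // IsPark c}) :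
    parkCoeff n p c = coeff (boundaryExp c.1) p := rfl

theorem IsPark.lt {c : Fin n → ℕ} (hc : IsPark c) (i : Fin n) : c i < n := by
  obtain ⟨σ, hσ⟩ := hc
  have := hσ (σ.symm i)
  rw [Equiv.apply_symm_apply] at this
  exact this.trans_lt (σ.symm i).2

instance : Finite {c : Fin n → ℕ // IsPark c} :=
  Finite.of_injective (fun c i => (⟨c.1 i, c.2.lt i⟩ : Fin n)) fun _ _ h =>
    Subtype.ext (funext fun i => Fin.val_eq_of_eq (congrFun h i))

/-- Were the image proper, a nonzero functional `f` would vanish on it. Take `c` with least level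
counts among those where `f` is nonzero on the basis vector. The triangular polynomial of `c`
involves, besides `c`, only parking functions with smaller level counts, where `f` vanishes; so `f`
is zero at `c` as well. -/
theorem map_parkCoeff_slimSpan (n : ℕ) : (slimSpan n).map (parkCoeff n) = ⊤ := by
  classical
  have := Fintype.ofFinite {c : Fin n → ℕ // IsPark c}
  by_contra hne
  obtain ⟨f, hf, hker⟩ := Submodule.exists_le_ker_of_lt_top _ (lt_top_iff_ne_top.2 hne)
  let S := Finset.univ.filter fun c => f (Pi.single c 1) ≠ 0
  have hS : S.Nonempty := by
    by_contra hS
    rw [Finset.not_nonempty_iff_eq_empty, Finset.filter_eq_empty_iff] at hS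
    exact hf (LinearMap.pi_ext' fun c => LinearMap.ext_ring (not_not.1 (hS (Finset.mem_univ c))))
  obtain ⟨c, hc, hmin⟩ := S.exists_min_image (fun c => toLex (levelCounts c.1)) hS
  obtain ⟨p, hp, hpc, hpb⟩ := c.2.exists_mem_slimSpan
  have h0 : f (parkCoeff n p) = 0 := hker (Submodule.mem_map_of_mem hp)
  have hsingle : ∀ c : {c : Fin n → ℕ // IsPark c},
      (fun j => if c = j then (1 : ℂ) else 0) = Pi.single c 1 := fun c => by
    ext j
    simp [Pi.single_apply, eq_comm]
  rw [LinearMap.pi_apply_eq_sum_univ f] at h0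
  simp_rw [hsingle] at h0
  rw [Finset.sum_eq_single c] at h0
  · rw [parkCoeff_apply, hpc, one_smul] at h0
    exact (Finset.mem_filter.1 hc).2 h0
  · intro b _ hb
    by_contra hne'
    have hlt := hpb b.1 (fun h => hb (Subtype.ext h)) (left_ne_zero_of_smul hne')
    refine (hmin b (Finset.mem_filter.2 ⟨Finset.mem_univ _, ?_⟩)).not_gt hlt
    exact right_ne_zero_of_smul hne'
  · simp

end Spanning

/-! ### Lattice paths and their row areas -/

section RowAreas

theorem le_of_mem_rowAreas {l : List DyckStep} {x y : ℕ} (h : y ∈ rowAreas x l) : x ≤ y := by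
  induction l generalizing x with
  | nil => simp [rowAreas] at h
  | cons s l ih =>
    cases s
    · rw [rowAreas, List.mem_cons] at h
      rcases h with rfl | h
      · exact le_rfl
      · exact ih h
    · exact (Nat.le_succ x).trans (ih h)

theorem pairwise_rowAreas (x : ℕ) (l : List DyckStep) : (rowAreas x l).Pairwise (· ≤ ·) := by
  induction l generalizing x with
  | nil => simp [rowAreas]
  | cons s l ih =>
    cases s
    · rw [rowAreas, List.pairwise_cons]
      exact ⟨fun y hy => le_of_mem_rowAreas hy, ih x⟩
    · exact ih (x + 1)

theorem length_rowAreas (x : ℕ) (l : List DyckStep) :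
    (rowAreas x l).length = l.count DyckStep.U := by
  induction l generalizing x with
  | nil => rfl
  | cons s l ih => cases s <;> simp [rowAreas, ih]

/-- The length of a column run is the number of rows with the corresponding area. -/
theorem columnRuns_eq_map_count (x : ℕ) (l : List DyckStep) :
    columnRuns l =
      (List.range (l.count DyckStep.D + 1)).map fun v => (rowAreas x l).count (x + v) := by
  induction l generalizing x with
  | nil => simp [columnRuns, rowAreas]
  | cons s l ih =>
    cases s
    · rw [columnRuns, ih x, List.count_cons_of_ne (by simp), List.range_succ_eq_map]
      simp [rowAreas]
    · rw [columnRuns, ih (x + 1), List.count_cons_self, List.range_succ_eq_map (n := _ + 1)]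
      simp only [rowAreas, List.map_cons, List.map_map, add_zero, List.cons.injEq]
      refine ⟨?_, ?_⟩
      · rw [eq_comm, List.count_eq_zero]
        intro h
        have := le_of_mem_rowAreas h
        omega
      · refine List.map_congr_left fun v _ => ?_
        simp only [Function.comp_apply, Nat.succ_eq_add_one, add_assoc, add_comm 1 v]

/-- Row areas do not see the horizontal steps after the last vertical one, hence the condition on
the counts of `D`. -/
theorem rowAreas_injective {l l' : List DyckStep} {x : ℕ} (h : rowAreas x l = rowAreas x l')
    (hD : l.count DyckStep.D = l'.count DyckStep.D) : l = l' := by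
  induction l generalizing x l' with
  | nil =>
    cases l' with
    | nil => rfl
    | cons s l' => cases s <;> simp [rowAreas] at h hD
  | cons s l ih =>
    cases l' with
    | nil => cases s <;> simp [rowAreas] at h hD
    | cons s' l' =>
      cases s <;> cases s'
      · rw [rowAreas, rowAreas, List.cons.injEq] at h
        rw [ih h.2 (by simpa using hD)]
      · rw [rowAreas, rowAreas] at h
        have : x ∈ rowAreas (x + 1) l' := h ▸ List.mem_cons_self
        have := le_of_mem_rowAreas this
        omega
      · rw [rowAreas, rowAreas] at h
        have : x ∈ rowAreas (x + 1) l := h ▸ List.mem_cons_self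
        have := le_of_mem_rowAreas this
        omega
      · rw [ih h (by simpa using hD)]

/-- The prefix condition of Dyck words in terms of the row areas. -/
theorem rowAreas_le_iff {x k : ℕ} {l : List DyckStep}
    (h : x + l.count DyckStep.D ≤ k + l.count DyckStep.U) :
    (∀ i (hi : i < (rowAreas x l).length), (rowAreas x l)[i] ≤ k + i) ↔
      ∀ i, x + (l.take i).count DyckStep.D ≤ k + (l.take i).count DyckStep.U := by
  induction l generalizing x k with
  -- Once no steps remain there are no rows to test, and the prefix condition rests on the
  -- assumption about the totals; this assumption also controls trailing horizontal steps.
  | nil => simpa [rowAreas] using h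
  | cons s l ih =>
    cases s
    · rw [List.count_cons_self, List.count_cons_of_ne (by simp)] at h
      have ih' := ih (x := x) (k := k + 1) (by omega)
      constructor
      · intro H i
        cases i with
        | zero =>
          exact H 0 (by simp [rowAreas])
        | succ i =>
          have := ih'.1 (fun i hi => by
            have := H (i + 1) (by simpa [rowAreas] using hi)
            simp only [rowAreas, List.getElem_cons_succ] at this
            omega) i
          rw [List.take_succ_cons, List.count_cons_self, List.count_cons_of_ne (by simp)]
          omega
      · intro H i hi
        cases i with
        | zero => simpa [rowAreas] using H 0
        | succ i =>
          have := ih'.2 (fun i => by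
            have := H (i + 1)
            rw [List.take_succ_cons, List.count_cons_self, List.count_cons_of_ne (by simp)] at this
            omega) i (by simpa [rowAreas] using hi)
          simp only [rowAreas, List.getElem_cons_succ]
          omega
    · rw [List.count_cons_self, List.count_cons_of_ne (by simp)] at h
      have ih' := ih (x := x + 1) (k := k) (by omega)
      rw [rowAreas, ih']
      constructor
      · intro H i
        cases i with
        | zero =>
          have := H 0
          simp only [List.take_zero, List.count_nil] at this ⊢
          omega
        | succ i =>
          have := H i
          rw [List.take_succ_cons, List.count_cons_self, List.count_cons_of_ne (by simp)]
          omega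
      · intro H i
        have := H (i + 1)
        rw [List.take_succ_cons, List.count_cons_self, List.count_cons_of_ne (by simp)] at this
        omega

/-- Greedy construction: go right until the next prescribed column, then up, and finish with
horizontal steps up to `N`. Each step lowers `N - x + b.length`. -/
theorem exists_rowAreas_eq {N x : ℕ} {b : List ℕ} (hb : b.Pairwise (· ≤ ·))
    (hmem : ∀ y ∈ b, x ≤ y ∧ y ≤ N) (hx : x ≤ N) :
    ∃ l, rowAreas x l = b ∧ x + l.count DyckStep.D = N := by
  induction hm : N - x + b.length using Nat.strong_induction_on generalizing x b with
  | _ m ih =>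
    cases b with
    | nil =>
      rcases hx.eq_or_lt with rfl | hx
      · exact ⟨[], rfl, by simp⟩
      · obtain ⟨l, h1, h2⟩ := ih (N - (x + 1) + ([] : List ℕ).length)
          (by simp only [List.length_nil] at hm ⊢; omega) List.Pairwise.nil (by simp) hx rfl
        refine ⟨DyckStep.D :: l, h1, ?_⟩
        rw [List.count_cons_self]
        omega
    | cons y b =>
      rw [List.length_cons] at hm
      have hy := hmem y List.mem_cons_self
      rw [List.pairwise_cons] at hb
      rcases hy.1.eq_or_lt with rfl | hlt
      · obtain ⟨l, h1, h2⟩ := ih _ (by omega) hb.2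
          (fun z hz => hmem z (List.mem_cons_of_mem _ hz)) hx rfl
        refine ⟨DyckStep.U :: l, by rw [rowAreas, h1], ?_⟩
        rwa [List.count_cons_of_ne (by simp)]
      · obtain ⟨l, h1, h2⟩ := ih (N - (x + 1) + (y :: b).length)
          (by rw [List.length_cons]; omega) (List.pairwise_cons.2 hb) (fun z hz => by
            refine ⟨?_, (hmem z hz).2⟩
            rcases List.mem_cons.1 hz with rfl | hz
            · exact hlt
            · exact Nat.lt_of_lt_of_le hlt (hb.1 z hz)) (by omega) rfl
        refine ⟨DyckStep.D :: l, h1, ?_⟩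
        rw [List.count_cons_self]
        omega

end RowAreas

/-! ### Rows, runs and blocks of a Dyck path -/

section DyckPath

variable {n : ℕ}

namespace DyckPath

/-- The areas of the rows of a Dyck path, from bottom to top. -/
def rows (D : DyckPath n) : List ℕ := rowAreas 0 D.1.toList

theorem count_D (D : DyckPath n) : D.1.toList.count DyckStep.D = n := by
  rw [← D.1.count_U_eq_count_D]
  exact D.2

theorem length_rows (D : DyckPath n) : D.rows.length = n := (length_rowAreas _ _).trans D.2

theorem rows_le (D : DyckPath n) (i : ℕ) (hi : i < D.rows.length) : D.rows[i] ≤ i := by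
  have h := (rowAreas_le_iff (x := 0) (k := 0) (l := D.1.toList)
    (by rw [D.1.count_U_eq_count_D])).2 (by simpa using D.1.count_D_le_count_U) i hi
  rwa [zero_add] at h

theorem eq_of_rows_perm {D D' : DyckPath n} (h : D.rows.Perm D'.rows) : D = D' := by
  refine Subtype.ext (DyckWord.ext (rowAreas_injective (x := 0) ?_ ?_))
  · exact h.eq_of_pairwise (fun _ _ _ _ => le_antisymm) (pairwise_rowAreas _ _)
      (pairwise_rowAreas _ _)
  · rw [D.count_D, D'.count_D]

theorem exists_rows_eq {c : Fin n → ℕ} (hc : IsPark c) :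
    ∃ D : DyckPath n, D.rows = List.ofFn (c ∘ Tuple.sort c) := by
  have hle := (isPark_iff_sort c).1 hc
  obtain ⟨l, hl, hD⟩ := exists_rowAreas_eq (N := n) (x := 0) (b := List.ofFn (c ∘ Tuple.sort c))
    (Tuple.monotone_sort c).sortedLE_ofFn.pairwise (fun y hy => by
      obtain ⟨i, rfl⟩ := List.mem_ofFn.1 hy
      exact ⟨Nat.zero_le _, (hle i).trans i.2.le⟩) (Nat.zero_le n)
  have hU : l.count DyckStep.U = n := by
    rw [← length_rowAreas 0, hl, List.length_ofFn]
  rw [zero_add] at hD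
  refine ⟨⟨⟨l, hU.trans hD.symm, fun i => ?_⟩, hU⟩, hl⟩
  have := (rowAreas_le_iff (x := 0) (k := 0) (l := l) (by omega)).1 (fun i hi => by
    simp only [hl, List.length_ofFn] at hi
    simpa [hl] using hle ⟨i, hi⟩) i
  omega

/-- The vertical run on the line `x = v` consists of the rows of area `v`; discarding zero runs
leaves the values that occur. -/
theorem runPartition_parts (D : DyckPath n) :
    D.runPartition.parts = D.rows.toFinset.val.map fun v => D.rows.count v := by
  have h : columnRuns D.1.toList =
      (List.range (n + 1)).map fun v => D.rows.count v := by
    rw [columnRuns_eq_map_count 0, D.count_D]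
    simp [rows]
  rw [runPartition, Nat.Partition.ofSums_parts, h, ← Multiset.map_coe, Multiset.filter_map]
  congr 1
  have h2 : D.rows.toFinset = (Finset.range (n + 1)).filter fun v => D.rows.count v ≠ 0 := by
    ext v
    simp only [List.mem_toFinset, Finset.mem_filter, Finset.mem_range, ne_eq,
      List.count_eq_zero, not_not, iff_and_self]
    intro hv
    obtain ⟨i, hi, rfl⟩ := List.getElem_of_mem hv
    have := D.rows_le i hi
    rw [D.length_rows] at hi
    omega
  rw [h2]
  rfl

end DyckPath

theorem exists_equiv_of_map_eq {α β γ : Type*} [Fintype α] [Fintype β] [DecidableEq γ]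
    {f : α → γ} {g : β → γ} (h : Finset.univ.val.map f = Finset.univ.val.map g) :
    ∃ e : α ≃ β, ∀ a, g (e a) = f a := by
  have hcard : ∀ c, Fintype.card {a // f a = c} = Fintype.card {b // g b = c} := by
    intro c
    have := congrArg (Multiset.count c) h
    rw [Multiset.count_map, Multiset.count_map] at this
    rw [Fintype.card_subtype, Fintype.card_subtype, Finset.card_def, Finset.card_def,
      Finset.filter_val, Finset.filter_val]
    simpa only [eq_comm] using this
  exact ⟨Equiv.ofFiberEquiv fun c => Fintype.equivOfCardEq (hcard c), fun a =>
    Equiv.ofFiberEquiv_map _ a⟩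

theorem card_filter_index_eq (c : Composition n) (t : Fin c.length) :
    (Finset.univ.filter fun i => c.index i = t).card = c.blocksFun t := by
  have h : (Finset.univ.filter fun i => c.index i = t) =
      Finset.univ.map (c.embedding t).toEmbedding := by
    ext i
    have := c.mem_range_embedding_iff' (j := i) (i := t)
    simp only [Finset.mem_filter, Finset.mem_univ, true_and, Finset.mem_map, Set.mem_range] at this ⊢
    rw [eq_comm, ← this]
    rfl
  rw [h, Finset.card_map, Finset.card_univ, Fintype.card_fin]

/-- A function with the multiset of values given by the rows of `D`, and with the blocks of the
run partition of `D` as its fibres. -/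
theorem DyckPath.exists_blockwise (D : DyckPath n) : ∃ a : Fin n → ℕ,
    Finset.univ.val.map a = (D.rows : Multiset ℕ) ∧
    ∀ i j, a i = a j ↔ (partitionComposition D.runPartition).index i =
      (partitionComposition D.runPartition).index j := by
  set c := partitionComposition D.runPartition with hc
  have hblocks : Finset.univ.val.map c.blocksFun =
      (Finset.univ : Finset D.rows.toFinset).val.map fun v => D.rows.count v.1 := by
    have h1 : Finset.univ.val.map c.blocksFun = (c.blocks : Multiset ℕ) := by
      rw [← c.ofFn_blocksFun]
      exact (Fin.univ_val_map _)
    have h2 : (c.blocks : Multiset ℕ) = D.runPartition.parts := by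
      rw [hc, partitionComposition]
      exact Multiset.sort_eq D.runPartition.parts (· ≥ ·)
    have h3 : (Finset.univ : Finset D.rows.toFinset).val.map (fun v => D.rows.count v.1) =
        ((Finset.univ : Finset D.rows.toFinset).val.map Subtype.val).map
          fun v => D.rows.count v := by
      rw [Multiset.map_map]
      rfl
    rw [h1, h2, D.runPartition_parts, h3]
    congr 1
    exact (Multiset.attach_map_val _).symm
  -- Block sizes and multiplicities of the row areas form the same multiset, so `e` labels each
  -- block with a distinct value whose multiplicity is the size of the block.
  obtain ⟨e, he⟩ := exists_equiv_of_map_eq hblocks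
  refine ⟨fun i => e (c.index i), ?_, fun i j => by
    rw [Subtype.coe_inj, e.injective.eq_iff]⟩
  ext v
  rw [Multiset.count_map, Multiset.coe_count]
  by_cases hv : v ∈ D.rows
  · have := he (e.symm ⟨v, by simpa using hv⟩)
    rw [Equiv.apply_symm_apply] at this
    rw [this, ← card_filter_index_eq, Finset.card_def, Finset.filter_val]
    congr 1
    refine Multiset.filter_congr fun i _ => ?_
    rw [Equiv.eq_symm_apply, Subtype.ext_iff, eq_comm]
  · rw [List.count_eq_zero_of_not_mem hv, Multiset.card_eq_zero, Multiset.filter_eq_nil]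
    rintro i - rfl
    exact hv (List.mem_toFinset.1 (e (c.index i)).2)

end DyckPath

/-! ### Parking functions as cosets of Young subgroups -/

section CosetParametrization

variable {n : ℕ}

theorem univ_val_map_comp_perm (c : Fin n → ℕ) (w : Equiv.Perm (Fin n)) :
    Finset.univ.val.map (c ∘ w) = Finset.univ.val.map c := by
  rw [← Multiset.map_map, Multiset.map_univ_val_equiv]

theorem IsPark.comp_perm {c : Fin n → ℕ} (hc : IsPark c) (w : Equiv.Perm (Fin n)) :
    IsPark (c ∘ w) := by
  obtain ⟨σ, hσ⟩ := hc
  exact ⟨σ.trans w.symm, fun k => by simpa using hσ k⟩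

theorem IsPark.of_map_eq {c c' : Fin n → ℕ} (hc : IsPark c)
    (h : Finset.univ.val.map c' = Finset.univ.val.map c) : IsPark c' := by
  obtain ⟨e, he⟩ := exists_equiv_of_map_eq h
  rw [← funext he]
  exact hc.comp_perm e

theorem DyckPath.isPark_of_map_eq (D : DyckPath n) {c : Fin n → ℕ}
    (h : Finset.univ.val.map c = (D.rows : Multiset ℕ)) : IsPark c := by
  refine IsPark.of_map_eq (c := fun i : Fin n => D.rows[i]'(by rw [D.length_rows]; exact i.2))
    ⟨1, fun k => D.rows_le k _⟩ ?_
  rw [h, Fin.univ_val_map]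
  congr 1
  refine List.ext_getElem (by simp [D.length_rows]) fun i _ _ => by simp

/-- The parking function with the blocks of the run partition of `D` as its fibres. -/
noncomputable def DyckPath.blockwise (D : DyckPath n) : Fin n → ℕ := D.exists_blockwise.choose

theorem DyckPath.map_blockwise (D : DyckPath n) :
    Finset.univ.val.map D.blockwise = (D.rows : Multiset ℕ) := D.exists_blockwise.choose_spec.1

theorem DyckPath.blockwise_eq_iff (D : DyckPath n) (i j : Fin n) :
    D.blockwise i = D.blockwise j ↔ (partitionComposition D.runPartition).index i =
      (partitionComposition D.runPartition).index j := D.exists_blockwise.choose_spec.2 i j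

/-- The fibres of `D.blockwise` are the blocks, so its stabilizer is the Young subgroup; this makes
`arrange` well defined and injective for each `D`. -/
theorem DyckPath.blockwise_comp_eq_iff (D : DyckPath n) (v w : Equiv.Perm (Fin n)) :
    D.blockwise ∘ v.symm = D.blockwise ∘ w.symm ↔ v⁻¹ * w ∈ youngSubgroup D.runPartition := by
  constructor
  · intro h i
    rw [← D.blockwise_eq_iff]
    simpa using congrFun h (w i)
  · intro h
    ext i
    have := (D.blockwise_eq_iff _ _).2 (h (w.symm i))
    simpa using this

/-- The arrangement `D.blockwise ∘ w⁻¹` for a coset `w S_λ`. -/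
noncomputable def DyckPath.arrange (D : DyckPath n)
    (q : Equiv.Perm (Fin n) ⧸ youngSubgroup D.runPartition) : Fin n → ℕ :=
  Quotient.liftOn' q (fun w => D.blockwise ∘ w.symm) fun v w h =>
    (D.blockwise_comp_eq_iff v w).2 (QuotientGroup.leftRel_apply.1 h)

theorem DyckPath.arrange_mk (D : DyckPath n) (w : Equiv.Perm (Fin n)) :
    D.arrange (QuotientGroup.mk w) = D.blockwise ∘ w.symm := rfl

theorem DyckPath.arrange_smul (D : DyckPath n) (w : Equiv.Perm (Fin n))
    (q : Equiv.Perm (Fin n) ⧸ youngSubgroup D.runPartition) :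
    D.arrange (w • q) = D.arrange q ∘ w.symm := by
  induction q using QuotientGroup.induction_on with
  | _ v => rfl

theorem DyckPath.map_arrange (D : DyckPath n)
    (q : Equiv.Perm (Fin n) ⧸ youngSubgroup D.runPartition) :
    Finset.univ.val.map (D.arrange q) = (D.rows : Multiset ℕ) := by
  induction q using QuotientGroup.induction_on with
  | _ v => rw [D.arrange_mk, univ_val_map_comp_perm, D.map_blockwise]

theorem DyckPath.sum_arrange (D : DyckPath n)
    (q : Equiv.Perm (Fin n) ⧸ youngSubgroup D.runPartition) : ∑ i, D.arrange q i = D.area := by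
  rw [Finset.sum, D.map_arrange, Multiset.sum_coe]
  rfl

/-- The parking functions of a given sum are parametrized by the cosets of the Young subgroups of
the Dyck paths of that area. -/
theorem arrange_bijective (n k : ℕ) : Function.Bijective
    (fun x : Σ D : {D : DyckPath n // D.area = k},
        Equiv.Perm (Fin n) ⧸ youngSubgroup D.1.runPartition =>
      (⟨x.1.1.arrange x.2, x.1.1.isPark_of_map_eq (x.1.1.map_arrange x.2),
        (x.1.1.sum_arrange x.2).trans x.1.2⟩ :
        {c : Fin n → ℕ // IsPark c ∧ ∑ i, c i = k})) := by
  constructor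
  · rintro ⟨⟨D, hD⟩, q⟩ ⟨⟨D', hD'⟩, q'⟩ h
    have h : D.arrange q = D'.arrange q' := congrArg Subtype.val h
    -- The multiset of values determines the sorted rows, and these determine the path.
    obtain rfl : D = D' := DyckPath.eq_of_rows_perm (Multiset.coe_eq_coe.1 (by
      rw [← D.map_arrange q, h, D'.map_arrange]))
    induction q using QuotientGroup.induction_on with
    | _ v =>
      induction q' using QuotientGroup.induction_on with
      | _ w =>
        congr 1
        exact QuotientGroup.eq.2 ((D.blockwise_comp_eq_iff v w).1 h)
  · rintro ⟨c, hc, hk⟩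
    obtain ⟨D, hD⟩ := DyckPath.exists_rows_eq hc
    have hrows : Finset.univ.val.map c = (D.rows : Multiset ℕ) := by
      rw [hD, ← Fin.univ_val_map, univ_val_map_comp_perm]
    obtain ⟨e, he⟩ := exists_equiv_of_map_eq (hrows.trans D.map_blockwise.symm)
    have harr : D.arrange (QuotientGroup.mk e.symm) = c := by
      rw [D.arrange_mk]
      exact funext he
    have harea : D.area = k := by
      rw [← D.sum_arrange (QuotientGroup.mk e.symm), harr, hk]
    exact ⟨⟨⟨D, harea⟩, QuotientGroup.mk e.symm⟩, Subtype.ext harr⟩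

end CosetParametrization

/-! ### Equivariance, grading and the isomorphisms -/

section Equivalences

variable {n : ℕ}

theorem permEmb_castSucc (w : Equiv.Perm (Fin n)) (i : Fin n) :
    permEmb n w i.castSucc = (w i).castSucc :=
  Equiv.Perm.viaEmbedding_apply w Fin.castSuccEmb i

theorem permEmb_last (w : Equiv.Perm (Fin n)) : permEmb n w (Fin.last n) = Fin.last n :=
  Equiv.Perm.viaEmbedding_apply_of_notMem w Fin.castSuccEmb _ (by simp)

theorem coeff_polyRep_permEmb (w : Equiv.Perm (Fin n)) (p : MvPolynomial (Fin (n + 1)) ℂ)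
    (c : Fin n → ℕ) :
    coeff (boundaryExp c) (polyRep (n + 1) (permEmb n w) p) = coeff (boundaryExp (c ∘ w)) p := by
  have h : boundaryExp c = Finsupp.mapDomain (permEmb n w) (boundaryExp (c ∘ w)) := by
    ext v
    obtain ⟨v, rfl⟩ := (permEmb n w).surjective v
    rw [Finsupp.mapDomain_apply (permEmb n w).injective]
    refine Fin.lastCases ?_ (fun i => ?_) v
    · rw [permEmb_last, boundaryExp_last, boundaryExp_last]
    · rw [permEmb_castSucc, boundaryExp_castSucc, boundaryExp_castSucc, Function.comp_apply]
  rw [h]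
  exact coeff_rename_mapDomain _ (permEmb n w).injective _ _

theorem isHomogeneous_graphWeight {m : ℕ} (G : SimpleGraph (Fin m)) :
    ∃ d, (graphWeight G).IsHomogeneous d := by
  classical
  exact ⟨_, IsHomogeneous.prod _ _ (fun _ => 1) fun e _ =>
    (isHomogeneous_X _ _).sub (isHomogeneous_X _ _)⟩

theorem homogeneousComponent_mem_slimSpan {p : MvPolynomial (Fin (n + 1)) ℂ}
    (hp : p ∈ slimSpan n) (k : ℕ) : homogeneousComponent k p ∈ slimSpan n := by
  induction hp using Submodule.span_induction with
  | mem p h =>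
    obtain ⟨G, hG, rfl⟩ := h
    obtain ⟨d, hd⟩ := isHomogeneous_graphWeight G
    rw [homogeneousComponent_of_mem hd]
    split_ifs
    · exact Submodule.subset_span ⟨G, hG, rfl⟩
    · exact Submodule.zero_mem _
  | zero => simp
  | add p q _ _ hp hq => rw [map_add]; exact Submodule.add_mem _ hp hq
  | smul a p _ hp => rw [map_smul]; exact Submodule.smul_mem _ a hp

theorem degree_boundaryExp (c : Fin n → ℕ) : (boundaryExp c).degree = ∑ i, c i := by
  rw [Finsupp.degree_eq_sum, Fin.sum_univ_castSucc]
  simp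

/-- The coefficients at a family of parking functions. -/
noncomputable def coeffMap {Ω : Type*} (W : Submodule ℂ (MvPolynomial (Fin (n + 1)) ℂ))
    (e : Ω → Fin n → ℕ) : W →ₗ[ℂ] (Ω → ℂ) :=
  (LinearMap.pi fun x => lcoeff ℂ (boundaryExp (e x))) ∘ₗ W.subtype

@[simp]
theorem coeffMap_apply {Ω : Type*} (W : Submodule ℂ (MvPolynomial (Fin (n + 1)) ℂ))
    (e : Ω → Fin n → ℕ) (p : W) (x : Ω) :
    coeffMap W e p x = coeff (boundaryExp (e x)) p.1 := rfl

theorem exists_mem_slimSpan_coeff_eq (f : {c : Fin n → ℕ // IsPark c} → ℂ) :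
    ∃ p ∈ slimSpan n, ∀ c, coeff (boundaryExp c.1) p = f c := by
  have h : f ∈ (slimSpan n).map (parkCoeff n) := by
    rw [map_parkCoeff_slimSpan]
    trivial
  obtain ⟨p, hp, rfl⟩ := h
  exact ⟨p, hp, fun _ => rfl⟩

theorem coeffMap_slimModule_bijective {Ω : Type*} (e : Ω → {c : Fin n → ℕ // IsPark c})
    (he : Function.Bijective e) :
    Function.Bijective (coeffMap (slimModule n).toSubmodule fun x => (e x).1) := by
  constructor
  · rw [injective_iff_map_eq_zero]
    rintro ⟨p, hp⟩ h
    refine Subtype.ext (eq_zero_of_coeff_park hp fun c hc => ?_)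
    obtain ⟨x, hx⟩ := he.2 ⟨c, hc⟩
    simpa [hx] using congrFun h x
  · intro f
    obtain ⟨p, hp, h⟩ := exists_mem_slimSpan_coeff_eq (f ∘ (Equiv.ofBijective e he).symm)
    refine ⟨⟨p, hp⟩, funext fun x => ?_⟩
    rw [coeffMap_apply, h, Function.comp_apply, Equiv.ofBijective_symm_apply_apply e he x]

theorem coeffMap_slimModuleDeg_bijective {Ω : Type*} (k : ℕ)
    (e : Ω → {c : Fin n → ℕ // IsPark c ∧ ∑ i, c i = k}) (he : Function.Bijective e) :
    Function.Bijective (coeffMap (slimModuleDeg n k).toSubmodule fun x => (e x).1) := by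
  classical
  constructor
  · rw [injective_iff_map_eq_zero]
    rintro ⟨p, hp⟩ h
    refine Subtype.ext (eq_zero_of_coeff_park hp.1 fun c hc => ?_)
    by_cases hk : ∑ i, c i = k
    · obtain ⟨x, hx⟩ := he.2 ⟨c, hc, hk⟩
      simpa [hx] using congrFun h x
    · exact IsHomogeneous.coeff_eq_zero hp.2 (by rwa [degree_boundaryExp])
  · intro f
    obtain ⟨p, hp, h⟩ := exists_mem_slimSpan_coeff_eq fun c : {c : Fin n → ℕ // IsPark c} =>
      if hk : ∑ i, c.1 i = k then f ((Equiv.ofBijective e he).symm ⟨c.1, c.2, hk⟩) else 0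
    -- The span has homogeneous generators, so passing to the component of degree `k` stays inside
    -- it and leaves the coefficients at exponents of sum `k` unchanged.
    refine ⟨⟨homogeneousComponent k p, homogeneousComponent_mem_slimSpan hp k,
      homogeneousComponent_isHomogeneous k p⟩, funext fun x => ?_⟩
    have hx := (e x).2
    rw [coeffMap_apply, coeff_homogeneousComponent, degree_boundaryExp, if_pos hx.2,
      h ⟨(e x).1, hx.1⟩, dif_pos hx.2]
    exact congrArg f (Equiv.ofBijective_symm_apply_apply e he x)

/-- Parking functions in zero-based form. -/
def ParkingFunction.pred (a : ParkingFunction n) : {c : Fin n → ℕ // IsPark c} :=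
  ⟨fun i => a.1 i - 1, Tuple.sort a.1, fun k => Nat.sub_le_of_le_add (a.2.2 k)⟩

theorem ParkingFunction.pred_bijective : Function.Bijective (ParkingFunction.pred (n := n)) := by
  constructor
  · intro a b h
    refine Subtype.ext (funext fun i => ?_)
    have h1 : a.1 i - 1 = b.1 i - 1 := congrFun (congrArg Subtype.val h) i
    have h2 := a.2.1 i
    have h3 := b.2.1 i
    omega
  · rintro ⟨c, hc⟩
    refine ⟨⟨fun i => c i + 1, fun i => Nat.le_add_left _ _, fun i => ?_⟩, rfl⟩
    have hmono : Monotone ((fun i => c i + 1) ∘ Tuple.sort c) := fun i j hij =>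
      Nat.succ_le_succ (Tuple.monotone_sort c hij)
    -- The sorting permutations of `c + 1` and `c` need not be compared: both rearrangements of `c +
    -- 1` are monotone, hence equal.
    rw [Tuple.unique_monotone (Tuple.monotone_sort _) hmono]
    exact Nat.succ_le_succ ((isPark_iff_sort c).1 hc i)

instance : Finite (ParkingFunction n) := Finite.of_injective _ ParkingFunction.pred_bijective.1

theorem nonempty_resSlim_equiv (n : ℕ) : Nonempty ((resSlim n).Equiv (parkModule n)) := by
  let L := LinearEquiv.ofBijective _ (coeffMap_slimModule_bijective _
    (ParkingFunction.pred_bijective (n := n)))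
  refine ⟨Representation.Equiv.mk (L ≪≫ₗ (Finsupp.linearEquivFunOnFinite ℂ ℂ _).symm ≪≫ₗ
    (MonoidAlgebra.coeffLinearEquiv ℂ).symm) fun w => LinearMap.ext fun p => ?_⟩
  refine MonoidAlgebra.ext (Finsupp.ext fun a => ?_)
  refine Eq.trans ?_ (Representation.coeff_ofMulAction w _ a).symm
  exact coeff_polyRep_permEmb w p.1 _

theorem nonempty_resSlimDeg_equiv (n k : ℕ) : Nonempty ((resSlimDeg n k).Equiv
    (Representation.directSum fun D : {D : DyckPath n // D.area = k} =>
      cosetModule D.1.runPartition)) := by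
  let L := LinearEquiv.ofBijective _ (coeffMap_slimModuleDeg_bijective k _ (arrange_bijective n k))
  let M : (⨁ D : {D : DyckPath n // D.area = k},
      MonoidAlgebra ℂ (Equiv.Perm (Fin n) ⧸ youngSubgroup D.1.runPartition)) ≃ₗ[ℂ]
      (D : {D : DyckPath n // D.area = k}) →
        (Equiv.Perm (Fin n) ⧸ youngSubgroup D.1.runPartition → ℂ) :=
    DirectSum.linearEquivFunOnFintype ℂ _ _ ≪≫ₗ LinearEquiv.piCongrRight fun D =>
      MonoidAlgebra.coeffLinearEquiv ℂ ≪≫ₗ Finsupp.linearEquivFunOnFinite ℂ ℂ _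
  have hM : ∀ x D q, M x D q = (x D).coeff q := fun _ _ _ => rfl
  refine ⟨Representation.Equiv.mk (L ≪≫ₗ LinearEquiv.piCurry ℂ (fun _ _ => ℂ) ≪≫ₗ M.symm)
    fun w => LinearMap.ext fun p => ?_⟩
  refine M.injective (funext fun D => funext fun q => ?_)
  simp only [LinearMap.comp_apply, LinearEquiv.coe_coe, LinearEquiv.trans_apply,
    LinearEquiv.apply_symm_apply]
  rw [hM, Representation.directSum_apply, DirectSum.lmap_apply, Representation.coeff_ofMulAction,
    ← hM, LinearEquiv.apply_symm_apply]
  change coeff _ (polyRep (n + 1) (permEmb n w) p.1) =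
    coeff (boundaryExp (D.1.arrange (w⁻¹ • q))) p.1
  rw [DyckPath.arrange_smul]
  exact coeff_polyRep_permEmb w p.1 _

end Equivalences

end SlimSubgraph

theorem theorem1 (n : ℕ) :
    (∀ k : ℕ, Nonempty ((SlimSubgraph.resSlimDeg n k).Equiv
      (Representation.directSum (fun D : {D : SlimSubgraph.DyckPath n // D.area = k} =>
        SlimSubgraph.cosetModule D.1.runPartition)))) ∧
    Nonempty ((SlimSubgraph.resSlim n).Equiv (SlimSubgraph.parkModule n)) :=
  ⟨SlimSubgraph.nonempty_resSlimDeg_equiv n, SlimSubgraph.nonempty_resSlim_equiv n⟩
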